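/- Let $\mathbb T=\mathbb R/\mathbb Z$, $f(x)=5x \bmod 1$, $H(x,y)=\sin(2\pi x)\cos(2\pi y)$ and $\delta\in\mathbb R$. For a Borel probability measure $\mu$ on $\mathbb T$ put $g_\mu(x)=x+\delta\int_{\mathbb T}H(x,y)\,d\mu(y) \bmod 1$ and define the self-consistent transfer operator (STO) by $\mathcal T\mu=f_*\big((g_\mu)_*\mu\big)$. Extend $\mathcal T$ to finite nonzero measures by replacing $\mu$ with $\mu/\mu(\mathbb T)$ in the definition of $g_\mu$, and write $\mathcal T\varphi$ for the continuous density of $\mathcal T(\varphi\,dx)$ when it exists. For $a,\alpha>0$ let $$\mathcal V_a=\Big\{\varphi\in C^1(\mathbb T,(0,\infty)):\ \tfrac{\varphi(x)}{\varphi(y)}\le e^{a|x-y|}\ \ \forall x,y\Big\},\qquad \mathcal C_\alpha=\Big\{\varphi\in C^2(\mathbb T,(0,\infty)):\ \Big|\tfrac{\varphi''}{\varphi}\Big|\le\alpha\Big\},$$ where $|x-y|$ is the arc distance on $\mathbb T$. The Hilbert metric of $\mathcal V_a$ is $d_{\mathcal V_a}(\varphi,\psi)=\log\big(M/m\big)\in[0,\infty]$,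 where $M=\inf\{\beta>0:\beta\psi-\varphi\in\mathcal V_a\}$ and $m=\sup\{\beta>0:\varphi-\beta\psi\in\mathcal V_a\}$ (with $\inf\emptyset=\infty$, $\sup\emptyset=0$). Let $d_W$ be the Wasserstein distance on probability measures, $d_W(\mu,\nu)=\sup\int\varphi\,d(\nu-\mu)$ over all $1$-Lipschitz $\varphi:\mathbb T\to\mathbb R$ with $|\varphi|\le1$. Then: 1. For every $\delta\in\mathbb R$, Lebesgue measure $\mathrm{Leb}$ and the Dirac mass $\delta_0$ are fixed by $\mathcal T$, and $\mathrm{Leb}\ne\delta_0$. 2. If $|\delta|<1/\pi$, then $\mathrm{Leb}$ is stable in the Hilbert metric: there are arbitrarily small $a,\alpha>0$ such that $\mathcal T$ maps $\mathcal V_a\cap\mathcal C_\alpha$ into itself, there is $\theta\in(0,1)$ with $d_{\mathcal V_a}(\mathcal T\varphi,\mathcal T\psi)\le\theta\, d_{\mathcal V_a}(\varphi,\psi)$ for all $\varphi,\psi\in\mathcal V_a\cap\mathcal C_\alpha$, and $d_{\mathcal V_a}(\mathcal T^n\varphi,1)\to0$ as $n\to\infty$ for all $\varphi\in\mathcal V_a\cap\mathcal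 C_\alpha$. 3. If $|5(1+2\pi\delta)|<1$, then $|\delta|<1/\pi$, and there is $\epsilon>0$ such that $\lim_{n\to\infty}d_W(\mathcal T^n\mu,\delta_0)=0$ for every Borel probability measure $\mu$ on $\mathbb T$ whose support is contained in an arc that contains $0$ and has diameter less than $\epsilon$. 4. Consequently, for all $\delta$ in a neighbourhood of $-1/(2\pi)$ one has $|\delta|<1/\pi$, and $\mathcal T$ has at least two stable fixed points: $\mathrm{Leb}$, in the sense of 2, and $\delta_0$, in the sense of 3. -/

import Mathlib

open MeasureTheory Filter Topology Set
open scoped ENNReal ContDiff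

namespace MeanField

noncomputable section

/-- The circle `ℝ / ℤ`; its distance is the arc-length distance and its `volume` is the
Lebesgue (Haar) probability measure. -/
abbrev Circ : Type := UnitAddCircle

/-! ### Self-consistent transfer operators -/

/-- The mean-field coupling map `g_μ(x) = x + δ ∫ H(x,y) dμ(y) mod 1`. The average `⨍` is the
integral with respect to `μ / μ(𝕋)`: it is the plain integral when `μ` is a probability measure,
and it is the extension that is homogeneous of degree zero for other finite nonzero measures. -/
def couplingMap (H : Circ → Circ → ℝ) (δ : ℝ) (μ : Measure Circ) (x : Circ) : Circ :=
  x + ((δ * ⨍ y, H x y ∂μ : ℝ) : Circ)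

/-- The self-consistent transfer operator `𝒯 μ = f_* ((g_μ)_* μ)`. -/
def sto (f : Circ → Circ) (H : Circ → Circ → ℝ) (δ : ℝ) (μ : Measure Circ) : Measure Circ :=
  (μ.map (couplingMap H δ μ)).map f

/-- The measure with density `φ` with respect to Lebesgue measure. -/
def densityMeasure (φ : Circ → ℝ) : Measure Circ :=
  (volume : Measure Circ).withDensity fun x => ENNReal.ofReal (φ x)

open Classical in
/-- The action of `𝒯` on densities: `stoDensity f H δ φ` is the (unique) continuous nonnegative
density of `𝒯 (φ dx)`, if there is one, and the zero function otherwise. -/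
def stoDensity (f : Circ → Circ) (H : Circ → Circ → ℝ) (δ : ℝ) (φ : Circ → ℝ) : Circ → ℝ :=
  if h : ∃ ψ : Circ → ℝ, Continuous ψ ∧ (∀ x, 0 ≤ ψ x) ∧
      densityMeasure ψ = sto f H δ (densityMeasure φ)
  then h.choose else 0

/-! ### Cones of densities and the Hilbert projective metric -/

/-- The cone `𝒱_a` of positive `C¹` functions on the circle with `φ(x)/φ(y) ≤ exp(a |x - y|)`. -/
def logLipCone (a : ℝ) : Set (Circ → ℝ) :=
  {φ | ContDiff ℝ 1 (fun t : ℝ => φ (t : Circ)) ∧ (∀ x, 0 < φ x) ∧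
    ∀ x y, φ x / φ y ≤ Real.exp (a * dist x y)}

/-- The cone `𝒞_α` of positive `C²` functions on the circle with `|φ''/φ| ≤ α`. -/
def secondDerivCone (α : ℝ) : Set (Circ → ℝ) :=
  {φ | ContDiff ℝ 2 (fun t : ℝ => φ (t : Circ)) ∧ (∀ x, 0 < φ x) ∧
    ∀ t : ℝ, |iteratedDeriv 2 (fun s : ℝ => φ (s : Circ)) t / φ (t : Circ)| ≤ α}

/-- `M_𝒱(φ,ψ) = inf {β > 0 : φ ≤ β ψ}` in `[0,∞]`, for the order `u ≤ v ↔ v - u ∈ 𝒱`. -/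
def hilbertUpper {E : Type*} [AddCommGroup E] [Module ℝ E] (V : Set E) (φ ψ : E) : ℝ≥0∞ :=
  ⨅ (β : ℝ) (_ : 0 < β ∧ β • ψ - φ ∈ V), ENNReal.ofReal β

/-- `m_𝒱(φ,ψ) = sup {β > 0 : φ ≥ β ψ}` in `[0,∞]` (zero if there is no such `β`). -/
def hilbertLower {E : Type*} [AddCommGroup E] [Module ℝ E] (V : Set E) (φ ψ : E) : ℝ≥0∞ :=
  ⨆ (β : ℝ) (_ : 0 < β ∧ φ - β • ψ ∈ V), ENNReal.ofReal β

/-- The Hilbert projective metric `log (M_𝒱(φ,ψ) / m_𝒱(φ,ψ))`, which may be `+∞`. -/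
def hilbertDist {E : Type*} [AddCommGroup E] [Module ℝ E] (V : Set E) (φ ψ : E) : EReal :=
  ENNReal.log (hilbertUpper V φ ψ / hilbertLower V φ ψ)

/-! ### Wasserstein distance -/

/-- The Wasserstein distance of two probability measures on the circle, in dual form: the supremum
of `∫ φ dν - ∫ φ dμ` over `1`-Lipschitz `φ` with `|φ| ≤ 1`. -/
def wassersteinDist (μ ν : Measure Circ) : ℝ :=
  sSup {r : ℝ | ∃ φ : Circ → ℝ, LipschitzWith 1 φ ∧ (∀ x, |φ x| ≤ 1) ∧
    r = (∫ x, φ x ∂ν) - ∫ x, φ x ∂μ}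

/-! ### The example -/

/-- `x ↦ 5 x mod 1`. -/
def timesFive (x : Circ) : Circ := 5 • x

theorem sin_two_pi_periodic : Function.Periodic (fun t : ℝ => Real.sin (2 * Real.pi * t)) 1 := by
  intro t
  simp [mul_add]

theorem cos_two_pi_periodic : Function.Periodic (fun t : ℝ => Real.cos (2 * Real.pi * t)) 1 := by
  intro t
  simp [mul_add]

/-- `H(x,y) = sin(2πx) cos(2πy)` on the circle. -/
def sinCos (x y : Circ) : ℝ := sin_two_pi_periodic.lift x * cos_two_pi_periodic.lift y

/-- `𝒯` for `f(x) = 5x mod 1` and `H(x,y) = sin(2πx) cos(2πy)`, on measures. -/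
def exSto (δ : ℝ) : Measure Circ → Measure Circ := sto timesFive sinCos δ

/-- `𝒯` for `f(x) = 5x mod 1` and `H(x,y) = sin(2πx) cos(2πy)`, on densities. -/
def exStoDensity (δ : ℝ) : (Circ → ℝ) → Circ → ℝ := stoDensity timesFive sinCos δ

/-- Lebesgue measure is a fixed point of `𝒯` that is stable in the Hilbert metric: for suitable
arbitrarily small `a, α > 0`, the operator `𝒯` acts on the densities in `𝒱_a ∩ 𝒞_α`, leaves this
set invariant, contracts the Hilbert metric of `𝒱_a` on it, and all orbits in it converge to the
constant density in this metric. -/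
def LebesgueHilbertStable (δ : ℝ) : Prop :=
  exSto δ volume = volume ∧
  ∀ ε : ℝ, 0 < ε → ∃ a ∈ Ioo 0 ε, ∃ α ∈ Ioo 0 ε,
    (∀ φ ∈ logLipCone a ∩ secondDerivCone α,
      densityMeasure (exStoDensity δ φ) = exSto δ (densityMeasure φ) ∧
      exStoDensity δ φ ∈ logLipCone a ∩ secondDerivCone α) ∧
    (∃ θ ∈ Ioo (0 : ℝ) 1, ∀ φ ∈ logLipCone a ∩ secondDerivCone α,
      ∀ ψ ∈ logLipCone a ∩ secondDerivCone α,
        hilbertDist (logLipCone a) (exStoDensity δ φ) (exStoDensity δ ψ) ≤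
          (θ : EReal) * hilbertDist (logLipCone a) φ ψ) ∧
    (∀ φ ∈ logLipCone a ∩ secondDerivCone α,
      Tendsto (fun n : ℕ => hilbertDist (logLipCone a) ((exStoDensity δ)^[n] φ) (fun _ => 1))
        atTop (𝓝 0))

/-- The Dirac mass at `0` is a fixed point of `𝒯` that attracts, in Wasserstein distance, all
probability measures whose support lies in an arc (a connected set) of diameter less than some
`ε > 0` that contains `0`. -/
def DiracWassersteinStable (δ : ℝ) : Prop :=
  exSto δ (Measure.dirac 0) = Measure.dirac 0 ∧
  ∃ ε : ℝ, 0 < ε ∧ ∀ μ : Measure Circ, IsProbabilityMeasure μ →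
    (∃ J : Set Circ, IsConnected J ∧ (0 : Circ) ∈ J ∧ Metric.diam J < ε ∧ μ.support ⊆ J) →
    Tendsto (fun n : ℕ => wassersteinDist ((exSto δ)^[n] μ) (Measure.dirac 0)) atTop (𝓝 0)

end

end MeanField

/-! Both fixed points come from explicit computations. The mean of `cos (2πy)` vanishes for Lebesgue
measure, so the coupling is trivial there and multiplication by 5 preserves the measure; the point 0
is fixed because `sin` vanishes there.

Stability of the Dirac mass is a linearization. If `μ` lives near 0, its mean field `c` is close to
1, and the lifted map has slope close to `5 (1 + 2πδ)` at 0, of modulus below 1. Hence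
`exists_abs_le_mul_abs` shrinks the radius of the support by a fixed factor at each step, and this
radius bounds the Wasserstein distance to `δ_0`.

For Lebesgue measure, densities are lifted to periodic functions on `ℝ` and measured by the sup
distance `D` of their logarithmic derivatives. With mean field `c` and `s = δ c`, a density is
transported by `x ↦ 5 (x + s sin 2πx)`, and the new logarithmic derivative is an average over five
inverse branches of one fifth of the old one plus a distortion of size about `4π²|s|`. Integration
by parts turns `2π c` into an integral of `sin` against the derivative of the normalized density, so
`2π c` varies by at most `0.71 D` (`abs_meanCos_sub_le`). Since `π|δ| < 1`, the distortion varies by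
at most about `1.42 D`, and the total rate is about `(1 + 1.42) / 5`, below `λ = 0.49`; all
remaining errors are of order `a D` (`abs_logDeriv_transfer_sub_le`).

The passage to the Hilbert metric `d` of `𝒱_a` uses two bounds: `(2/a) D ≤ d` always
(`abs_logDeriv_sub_le_hilbertDist`), and `d ≤ 2 (D + D / ((1 - λ) a))` when both logarithmic
derivatives are at most `λ a` (`hilbertDist_le`). Images satisfy the latter condition, so `d`
contracts by `λ a + λ / (1 - λ)`, which is below 1 for small `a` exactly because `λ < 1/2`. The cone
`𝒞_α`, with `α = 100 a`, makes logarithmic derivatives Lipschitz; this is needed to compare them at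
preimages under two different covering maps. -/

namespace MeanField

/-! ### The coupling map in coordinates -/

/-- The mean of `cos (2πy)` with respect to the normalization of `μ`. -/
noncomputable def cosMean (μ : Measure Circ) : ℝ := ⨍ y, cos_two_pi_periodic.lift y ∂μ

theorem continuous_sin_lift : Continuous (sin_two_pi_periodic.lift : Circ → ℝ) :=
  continuous_coinduced_dom.mpr (by
    show Continuous fun t : ℝ => Real.sin (2 * Real.pi * t)
    fun_prop)

theorem continuous_cos_lift : Continuous (cos_two_pi_periodic.lift : Circ → ℝ) :=
  continuous_coinduced_dom.mpr (by
    show Continuous fun t : ℝ => Real.cos (2 * Real.pi * t)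
    fun_prop)

theorem couplingMap_sinCos (δ : ℝ) (μ : Measure Circ) (x : Circ) :
    couplingMap sinCos δ μ x =
      x + ((δ * cosMean μ * sin_two_pi_periodic.lift x : ℝ) : Circ) := by
  have h : ⨍ y, sinCos x y ∂μ = sin_two_pi_periodic.lift x * cosMean μ := by
    simp only [sinCos, cosMean, average, integral_const_mul]
  rw [couplingMap, h]
  congr 2
  ring

theorem couplingMap_sinCos_coe (δ : ℝ) (μ : Measure Circ) (t : ℝ) :
    couplingMap sinCos δ μ (t : Circ) =
      ((t + δ * cosMean μ * Real.sin (2 * Real.pi * t) : ℝ) : Circ) := by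
  rw [couplingMap_sinCos, Function.Periodic.lift_coe, AddCircle.coe_add]

theorem continuous_couplingMap_sinCos (δ : ℝ) (μ : Measure Circ) :
    Continuous (couplingMap sinCos δ μ) := by
  have h : couplingMap sinCos δ μ = fun x : Circ =>
      x + ((δ * cosMean μ * sin_two_pi_periodic.lift x : ℝ) : Circ) :=
    funext (couplingMap_sinCos δ μ)
  rw [h]
  exact continuous_id.add
    ((AddCircle.continuous_mk' 1).comp (continuous_const.mul continuous_sin_lift))

theorem continuous_timesFive : Continuous timesFive := continuous_nsmul 5

theorem exSto_eq_map (δ : ℝ) (μ : Measure Circ) :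
    exSto δ μ = μ.map (fun x => timesFive (couplingMap sinCos δ μ x)) :=
  Measure.map_map continuous_timesFive.measurable (continuous_couplingMap_sinCos δ μ).measurable

theorem timesFive_couplingMap_coe (δ : ℝ) (μ : Measure Circ) (t : ℝ) :
    timesFive (couplingMap sinCos δ μ (t : Circ)) =
      ((5 * (t + δ * cosMean μ * Real.sin (2 * Real.pi * t)) : ℝ) : Circ) := by
  rw [couplingMap_sinCos_coe, timesFive, ← AddCircle.coe_nsmul, nsmul_eq_mul]
  norm_num

instance isProbabilityMeasure_exSto (δ : ℝ) (μ : Measure Circ) [IsProbabilityMeasure μ] :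
    IsProbabilityMeasure (exSto δ μ) := by
  rw [exSto_eq_map]
  exact Measure.isProbabilityMeasure_map
    (continuous_timesFive.comp (continuous_couplingMap_sinCos δ μ)).measurable.aemeasurable

/-! ### The two fixed points -/

theorem cosMean_volume : cosMean volume = 0 := by
  have : IsProbabilityMeasure (volume : Measure Circ) := ⟨UnitAddCircle.measure_univ⟩
  rw [cosMean, average_eq_integral, ← UnitAddCircle.intervalIntegral_preimage 0]
  simp only [Function.Periodic.lift_coe]
  have hpi : (2 * Real.pi) ≠ 0 := by positivity
  rw [intervalIntegral.integral_comp_mul_left (fun x => Real.cos x) hpi]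
  simp

theorem exSto_volume (δ : ℝ) : exSto δ volume = volume := by
  rw [exSto_eq_map]
  simp only [couplingMap_sinCos, cosMean_volume, mul_zero, zero_mul, AddCircle.coe_zero, add_zero]
  exact (AddCircle.ergodic_nsmul (T := 1) (n := 5) (by norm_num)).toMeasurePreserving.map_eq

theorem exSto_dirac (δ : ℝ) : exSto δ (Measure.dirac 0) = Measure.dirac 0 := by
  have hm : Measurable fun x => timesFive (couplingMap sinCos δ (Measure.dirac 0) x) :=
    (continuous_timesFive.comp (continuous_couplingMap_sinCos δ _)).measurable
  rw [exSto_eq_map, Measure.map_dirac' hm]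
  have := timesFive_couplingMap_coe δ (Measure.dirac 0) 0
  simp only [AddCircle.coe_zero] at this
  rw [this]
  simp

theorem volume_ne_dirac : (volume : Measure Circ) ≠ Measure.dirac 0 := by
  intro h
  have h1 : (volume : Measure Circ) {0} = 0 := by
    have := AddCircle.volume_closedBall (T := 1) (x := 0) 0
    simpa using this
  rw [h] at h1
  simp at h1

/-! ### Stability of the Dirac mass -/

/-- A 1-Lipschitz test function satisfies `φ 0 - φ x ≤ ‖x‖ ≤ r` almost everywhere; the zero test
function gives the lower bound. -/
theorem wassersteinDist_dirac_mem_Icc (μ : Measure Circ) [IsProbabilityMeasure μ] {r : ℝ}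
    (hμ : ∀ᵐ x ∂μ, ‖x‖ ≤ r) :
    0 ≤ wassersteinDist μ (Measure.dirac 0) ∧ wassersteinDist μ (Measure.dirac 0) ≤ r := by
  have hub : ∀ c ∈ {c : ℝ | ∃ φ : Circ → ℝ, LipschitzWith 1 φ ∧ (∀ x, |φ x| ≤ 1) ∧
      c = (∫ x, φ x ∂(Measure.dirac 0)) - ∫ x, φ x ∂μ}, c ≤ r := by
    rintro c ⟨φ, hφ, hb, rfl⟩
    have hint : Integrable φ μ := Integrable.of_bound
      hφ.continuous.measurable.aestronglyMeasurable 1 (Eventually.of_forall hb)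
    rw [integral_dirac]
    have h1 : ∫ _, (φ 0 - r) ∂μ ≤ ∫ x, φ x ∂μ := by
      refine integral_mono_ae (integrable_const _) hint ?_
      filter_upwards [hμ] with x hx
      have := hφ.dist_le_mul 0 x
      rw [Real.dist_eq, dist_zero_left] at this
      have := (abs_le.mp this).2
      simp only [NNReal.coe_one, one_mul] at this
      linarith
    simp at h1
    linarith
  refine ⟨le_csSup ⟨r, hub⟩ ⟨fun _ => 0, LipschitzWith.const' 0, by simp, by simp⟩,
    csSup_le ⟨0, fun _ => 0, LipschitzWith.const' 0, by simp, by simp⟩ hub⟩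

theorem norm_coe_le_abs (t : ℝ) : ‖(t : Circ)‖ ≤ |t| := by
  rw [UnitAddCircle.norm_eq]
  simpa using round_le t 0

theorem exists_coe_eq_norm (x : Circ) : ∃ t : ℝ, (t : Circ) = x ∧ |t| = ‖x‖ := by
  induction x using QuotientAddGroup.induction_on with
  | H t =>
    refine ⟨t - round t, ?_, (UnitAddCircle.norm_eq).symm⟩
    rw [AddCircle.coe_sub, sub_eq_self, AddCircle.coe_eq_zero_iff]
    exact ⟨round t, by simp⟩

theorem exists_coe_eq_dist (x y : Circ) :
    ∃ s t : ℝ, (s : Circ) = x ∧ (t : Circ) = y ∧ |s - t| = dist x y := by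
  obtain ⟨u, hu, hun⟩ := exists_coe_eq_norm (x - y)
  obtain ⟨t, ht, -⟩ := exists_coe_eq_norm y
  refine ⟨u + t, t, ?_, ht, ?_⟩
  · rw [AddCircle.coe_add, hu, ht, sub_add_cancel]
  · rw [add_sub_cancel_right, hun, dist_eq_norm]

/-- Near the fixed point the lifted map contracts, uniformly in mean fields close to `1`. -/
theorem exists_abs_le_mul_abs {δ κ : ℝ} (hκ : |5 * (1 + 2 * Real.pi * δ)| < κ) :
    ∃ η > 0, ∀ c t : ℝ, |c - 1| < η → |t| < η →
      |5 * (t + δ * c * Real.sin (2 * Real.pi * t))| ≤ κ * |t| := by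
  -- Writing `sin` through `sinc` makes the quotient of the lifted map by `t` jointly continuous in
  -- `(c, t)`, also at `t = 0`. At `(1, 0)` it is the multiplier `5 (1 + 2πδ)`.
  have hcont : Continuous fun z : ℝ × ℝ =>
      |5 * (1 + 2 * Real.pi * δ * z.1 * Real.sinc (2 * Real.pi * z.2))| := by fun_prop
  have hev : ∀ᶠ z : ℝ × ℝ in 𝓝 (1, 0),
      |5 * (1 + 2 * Real.pi * δ * z.1 * Real.sinc (2 * Real.pi * z.2))| < κ :=
    hcont.continuousAt.eventually_lt continuousAt_const (by simpa using hκ)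
  obtain ⟨η, hη, hball⟩ := Metric.eventually_nhds_iff.mp hev
  refine ⟨η, hη, fun c t hc ht => ?_⟩
  have hlt : dist ((c, t) : ℝ × ℝ) (1, 0) < η := by
    rw [Prod.dist_eq, Real.dist_eq, Real.dist_eq]
    simpa using ⟨hc, ht⟩
  have h := (hball hlt).le
  have hsin : Real.sin (2 * Real.pi * t) = Real.sinc (2 * Real.pi * t) * (2 * Real.pi * t) := by
    rcases eq_or_ne t 0 with rfl | h0
    · simp
    · rw [Real.sinc_of_ne_zero (by positivity)]
      have := Real.pi_pos.ne'
      field_simp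
  have heq : 5 * (t + δ * c * Real.sin (2 * Real.pi * t)) =
      5 * (1 + 2 * Real.pi * δ * c * Real.sinc (2 * Real.pi * t)) * t := by
    rw [hsin]
    ring
  rw [heq, abs_mul]
  exact mul_le_mul_of_nonneg_right h (abs_nonneg t)

theorem abs_cosMean_sub_one_le (μ : Measure Circ) [IsProbabilityMeasure μ] {r η : ℝ}
    (hμ : ∀ᵐ x ∂μ, ‖x‖ ≤ r) (hr : ∀ t : ℝ, |t| ≤ r → |Real.cos (2 * Real.pi * t) - 1| ≤ η) :
    |cosMean μ - 1| ≤ η := by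
  have hb : ∀ x : Circ, |cos_two_pi_periodic.lift x| ≤ 1 := by
    intro x
    induction x using QuotientAddGroup.induction_on with
    | H t => exact Real.abs_cos_le_one _
  have hint : Integrable (cos_two_pi_periodic.lift : Circ → ℝ) μ := Integrable.of_bound
    continuous_cos_lift.measurable.aestronglyMeasurable 1 (Eventually.of_forall hb)
  have h1 : cosMean μ - 1 = ∫ y, (cos_two_pi_periodic.lift y - 1) ∂μ := by
    rw [cosMean, average_eq_integral, integral_sub hint (integrable_const _)]
    simp
  rw [h1]
  have h2 := norm_integral_le_of_norm_le_const (μ := μ) (C := η)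
    (f := fun y : Circ => cos_two_pi_periodic.lift y - 1) (by
      filter_upwards [hμ] with x hx
      obtain ⟨t, rfl, ht⟩ := exists_coe_eq_norm x
      exact hr t (ht.le.trans hx))
  simpa using h2

theorem diracWassersteinStable {δ : ℝ} (hδ : |5 * (1 + 2 * Real.pi * δ)| < 1) :
    DiracWassersteinStable δ := by
  refine ⟨exSto_dirac δ, ?_⟩
  obtain ⟨κ, hκ, hκ1⟩ := exists_between hδ
  have hκ0 : 0 ≤ κ := (abs_nonneg _).trans hκ.le
  obtain ⟨η, hη, hcontr⟩ := exists_abs_le_mul_abs hκ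
  have hcos : ∀ᶠ t : ℝ in 𝓝 0, |Real.cos (2 * Real.pi * t) - 1| < η / 2 := by
    have hc : Continuous fun t : ℝ => |Real.cos (2 * Real.pi * t) - 1| := by fun_prop
    exact hc.continuousAt.eventually_lt continuousAt_const (by simpa using by positivity)
  obtain ⟨ρ, hρ, hball⟩ := Metric.eventually_nhds_iff.mp hcos
  refine ⟨min (η / 2) (ρ / 2), by positivity, fun μ hμ ⟨J, hJ, h0, hdiam, hsupp⟩ => ?_⟩
  set r := min (η / 2) (ρ / 2)
  have hrη : r ≤ η / 2 := min_le_left _ _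
  have hrρ : r ≤ ρ / 2 := min_le_right _ _
  have hr0 : 0 ≤ r := by positivity
  have hstart : ∀ᵐ x ∂μ, ‖x‖ ≤ r := by
    filter_upwards [Measure.support_mem_ae (μ := μ)] with x hx
    have := Metric.dist_le_diam_of_mem (Bornology.IsBounded.all J) (hsupp hx) h0
    rw [dist_zero_right] at this
    exact this.trans hdiam.le
  -- The map changes with the measure. The induction closes because a smaller support keeps the mean
  -- field within `η` of 1, where the contraction by `κ` holds.
  have hiter : ∀ n : ℕ, IsProbabilityMeasure ((exSto δ)^[n] μ) ∧
      ∀ᵐ x ∂((exSto δ)^[n] μ), ‖x‖ ≤ κ ^ n * r := by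
    intro n
    induction n with
    | zero => exact ⟨hμ, by simpa using hstart⟩
    | succ n ih =>
      obtain ⟨hp, hae⟩ := ih
      rw [Function.iterate_succ_apply']
      set ν := (exSto δ)^[n] μ
      refine ⟨inferInstance, ?_⟩
      have hmeas : Measurable fun x => timesFive (couplingMap sinCos δ ν x) :=
        (continuous_timesFive.comp (continuous_couplingMap_sinCos δ ν)).measurable
      have hκn : κ ^ n * r ≤ r := mul_le_of_le_one_left hr0 (pow_le_one₀ hκ0 hκ1.le)
      have hmean : |cosMean ν - 1| ≤ η / 2 := by
        refine abs_cosMean_sub_one_le ν hae fun t ht => (hball ?_).le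
        rw [dist_zero_right, Real.norm_eq_abs]
        linarith
      rw [exSto_eq_map, ae_map_iff hmeas.aemeasurable
        (measurableSet_le continuous_norm.measurable measurable_const)]
      filter_upwards [hae] with x hx
      obtain ⟨t, rfl, ht⟩ := exists_coe_eq_norm x
      rw [timesFive_couplingMap_coe]
      refine (norm_coe_le_abs _).trans ((hcontr _ t (by linarith) (by linarith)).trans ?_)
      rw [ht, pow_succ', mul_assoc]
      exact mul_le_mul_of_nonneg_left hx hκ0
  refine squeeze_zero (g := fun n => κ ^ n * r) (fun n => ?_) (fun n => ?_) ?_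
  · have := (hiter n).1
    exact (wassersteinDist_dirac_mem_Icc _ (hiter n).2).1
  · have := (hiter n).1
    exact (wassersteinDist_dirac_mem_Icc _ (hiter n).2).2
  · simpa using (tendsto_pow_atTop_nhds_zero_of_lt_one hκ0 hκ1).mul_const r

/-- The hypothesis puts `2πδ` in `(-6/5, -4/5)`, so `π|δ| < 3/5`. -/
theorem abs_lt_one_div_pi_of_abs_lt_one {δ : ℝ} (hδ : |5 * (1 + 2 * Real.pi * δ)| < 1) :
    |δ| < 1 / Real.pi := by
  rw [lt_div_iff₀ Real.pi_pos, ← abs_of_pos Real.pi_pos, ← abs_mul, abs_lt]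
  obtain ⟨h1, h2⟩ := abs_lt.mp hδ
  constructor <;> nlinarith

/-! ### Logarithmic derivatives and the cone of log-Lipschitz densities -/

theorem hasDerivAt_log_sub_log {u v : ℝ → ℝ} (hu : Differentiable ℝ u) (hv : Differentiable ℝ v)
    (hu0 : ∀ x, 0 < u x) (hv0 : ∀ x, 0 < v x) (t : ℝ) :
    HasDerivAt (fun x => Real.log (u x) - Real.log (v x)) (logDeriv u t - logDeriv v t) t :=
  ((hu t).hasDerivAt.log (hu0 t).ne').sub ((hv t).hasDerivAt.log (hv0 t).ne')

theorem abs_log_sub_log_sub_le {u v : ℝ → ℝ} {D : ℝ} (hu : Differentiable ℝ u)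
    (hv : Differentiable ℝ v) (hu0 : ∀ x, 0 < u x) (hv0 : ∀ x, 0 < v x)
    (h : ∀ x, |logDeriv u x - logDeriv v x| ≤ D) (s t : ℝ) :
    |(Real.log (u s) - Real.log (v s)) - (Real.log (u t) - Real.log (v t))| ≤ D * |s - t| :=
  Convex.norm_image_sub_le_of_norm_hasDerivWithin_le (s := univ) (C := D)
    (fun x _ => (hasDerivAt_log_sub_log hu hv hu0 hv0 x).hasDerivWithinAt)
    (fun x _ => h x) convex_univ (mem_univ t) (mem_univ s)

theorem logDeriv_abs_le_iff {u : ℝ → ℝ} {a t : ℝ} (hu : 0 < u t) :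
    |logDeriv u t| ≤ a ↔ |deriv u t| ≤ a * u t := by
  rw [logDeriv_apply, abs_div, abs_of_pos hu, div_le_iff₀ hu]

/-- Both sides say that `log φ` is `a`-Lipschitz. Arc distance is at most distance on the line, and
`exists_coe_eq_dist` supplies representatives where the two agree. -/
theorem mem_logLipCone_iff {a : ℝ} (ha : 0 < a) {φ : Circ → ℝ} :
    φ ∈ logLipCone a ↔ ContDiff ℝ 1 (fun t : ℝ => φ t) ∧ (∀ t : ℝ, 0 < φ t) ∧
      ∀ t : ℝ, |deriv (fun t : ℝ => φ t) t| ≤ a * φ t := by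
  constructor
  · rintro ⟨hC, hpos, hL⟩
    refine ⟨hC, fun t => hpos t, fun t => ?_⟩
    have hd : Differentiable ℝ fun t : ℝ => φ t := hC.differentiable one_ne_zero
    have key : ∀ x y : ℝ, Real.log (φ x) - Real.log (φ y) ≤ a * |x - y| := by
      intro x y
      rw [← Real.log_div (hpos _).ne' (hpos _).ne', Real.log_le_iff_le_exp
        (div_pos (hpos _) (hpos _))]
      refine (hL x y).trans (Real.exp_le_exp.mpr (mul_le_mul_of_nonneg_left ?_ ha.le))
      rw [dist_eq_norm, ← AddCircle.coe_sub]
      exact norm_coe_le_abs _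
    have hlip : LipschitzWith a.toNNReal (fun t : ℝ => Real.log (φ t)) := by
      refine LipschitzWith.of_dist_le_mul fun x y => ?_
      rw [Real.dist_eq, Real.dist_eq, abs_le, Real.coe_toNNReal a ha.le]
      refine ⟨?_, key x y⟩
      have := key y x
      rw [abs_sub_comm] at this
      linarith
    have h1 := norm_deriv_le_of_lipschitz hlip (x₀ := t)
    rw [Real.coe_toNNReal a ha.le, ((hd t).hasDerivAt.log (hpos t).ne').deriv] at h1
    exact (logDeriv_abs_le_iff (u := fun t : ℝ => φ t) (hpos t)).mp h1
  · rintro ⟨hC, hpos, hL⟩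
    have hd : Differentiable ℝ fun t : ℝ => φ t := hC.differentiable one_ne_zero
    have hpos' : ∀ x : Circ, 0 < φ x := fun x => by
      induction x using QuotientAddGroup.induction_on with
      | H t => exact hpos t
    refine ⟨hC, hpos', fun x y => ?_⟩
    obtain ⟨s, t, rfl, rfl, hst⟩ := exists_coe_eq_dist x y
    have h := abs_log_sub_log_sub_le (u := fun t : ℝ => φ t) (v := fun _ => 1) (D := a) hd
      (differentiable_const _) hpos (fun _ => one_pos)
      (fun x => by simpa using (logDeriv_abs_le_iff (u := fun t : ℝ => φ t) (hpos x)).mpr (hL x))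
      s t
    rw [← Real.log_le_iff_le_exp (div_pos (hpos _) (hpos _)),
      Real.log_div (hpos _).ne' (hpos _).ne', ← hst]
    simpa using (abs_le.mp h).2

/-- Two coefficients are kept so that one lemma serves both `β ψ - φ` and `φ - γ ψ`. -/
theorem smul_sub_mem_logLipCone_iff {a : ℝ} (ha : 0 < a) {φ ψ : Circ → ℝ}
    (hφ : ContDiff ℝ 1 (fun t : ℝ => φ t)) (hψ : ContDiff ℝ 1 (fun t : ℝ => ψ t)) (β γ : ℝ) :
    β • ψ - γ • φ ∈ logLipCone a ↔ ∀ t : ℝ, 0 < β * ψ t - γ * φ t ∧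
      |β * deriv (fun t : ℝ => ψ t) t - γ * deriv (fun t : ℝ => φ t) t| ≤
        a * (β * ψ t - γ * φ t) := by
  have hder : ∀ t : ℝ, deriv (fun t : ℝ => (β • ψ - γ • φ) (t : Circ)) t =
      β * deriv (fun t : ℝ => ψ t) t - γ * deriv (fun t : ℝ => φ t) t := fun t =>
    (((hψ.differentiable one_ne_zero t).hasDerivAt.const_mul β).sub
      ((hφ.differentiable one_ne_zero t).hasDerivAt.const_mul γ)).deriv
  rw [mem_logLipCone_iff ha]
  simp only [hder]
  simp only [Pi.sub_apply, Pi.smul_apply, smul_eq_mul]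
  exact ⟨fun h t => ⟨h.2.1 t, h.2.2 t⟩, fun h =>
    ⟨(contDiff_const.mul hψ).sub (contDiff_const.mul hφ), fun t => (h t).1, fun t => (h t).2⟩⟩

/-! ### The Hilbert metric of the cone in terms of logarithmic derivatives -/

/-- The function `log ((1 + x) / (1 - x))` has derivative `2 / (1 - x²) ≥ 2`. This is the source of
the factor `2/a` in the lower bound for the Hilbert metric. -/
theorem two_mul_sub_le_log_sub_log {x y : ℝ} (hy : -1 < y) (hxy : y ≤ x) (hx : x < 1) :
    2 * (x - y) ≤ (Real.log (1 + x) - Real.log (1 - x)) -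
      (Real.log (1 + y) - Real.log (1 - y)) := by
  have hmono : MonotoneOn (fun z : ℝ => Real.log (1 + z) - Real.log (1 - z) - 2 * z)
      (Ioo (-1) 1) := by
    have hd : ∀ z ∈ Ioo (-1 : ℝ) 1, HasDerivAt
        (fun z : ℝ => Real.log (1 + z) - Real.log (1 - z) - 2 * z)
        (1 / (1 + z) - (-1) / (1 - z) - 2 * 1) z := by
      intro z hz
      have h1 : 1 + z ≠ 0 := by linarith [hz.1]
      have h2 : 1 - z ≠ 0 := by linarith [hz.2]
      exact ((((hasDerivAt_id z).const_add 1).log h1).sub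
        (((hasDerivAt_id z).const_sub 1).log h2)).sub ((hasDerivAt_id z).const_mul 2)
    refine monotoneOn_of_deriv_nonneg (convex_Ioo _ _)
      (fun z hz => (hd z hz).continuousAt.continuousWithinAt)
      (fun z hz => (hd z (interior_subset hz)).differentiableAt.differentiableWithinAt)
      fun z hz => ?_
    have hz' := interior_subset hz
    rw [(hd z hz').deriv]
    have h1 : 0 < 1 + z := by linarith [hz'.1]
    have h2 : 0 < 1 - z := by linarith [hz'.2]
    have : 1 / (1 + z) - (-1) / (1 - z) - 2 * 1 = 2 * z ^ 2 / ((1 + z) * (1 - z)) := by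
      field_simp
      ring
    rw [this]
    positivity
  have := hmono (a := y) (b := x) ⟨hy, by linarith⟩ ⟨by linarith, hx⟩ hxy
  simp only at this
  linarith

/-- The cone conditions at one point, where `k = u/v` and `p`, `q` are the logarithmic derivatives
of `u`, `v`, give `β/γ ≥ (a + p)(a - q) / ((a + q)(a - p))`. The case `p = q` is separate, since
there `a - p` or `a + q` may vanish. -/
theorem exp_mul_le_of_cone_bounds {a p q k β γ : ℝ} (ha : 0 < a) (hp : |p| ≤ a) (hq : |q| ≤ a)
    (hk : 0 < k) (hγ : 0 < γ) (hβ : 0 < β) (hpq : q ≤ p) (h0 : γ ≤ β)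
    (h1 : (a + p) * k ≤ β * (a + q)) (h2 : γ * (a - q) ≤ (a - p) * k) :
    Real.exp (2 / a * (p - q)) * γ ≤ β := by
  obtain ⟨hp1, hp2⟩ := abs_le.mp hp
  obtain ⟨hq1, hq2⟩ := abs_le.mp hq
  rcases hpq.eq_or_lt with rfl | hlt
  · simpa using h0
  have hx : 0 < a - p := pos_of_mul_pos_left ((mul_pos hγ (by linarith)).trans_le h2) hk.le
  have hy : 0 < a + q := pos_of_mul_pos_right ((mul_pos (by linarith) hk).trans_le h1) hβ.le
  have hx1 : 0 < a + p := by linarith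
  have hy1 : 0 < a - q := by linarith
  have key := two_mul_sub_le_log_sub_log (x := p / a) (y := q / a)
    (by rw [lt_div_iff₀ ha]; linarith) (by gcongr) (by rw [div_lt_one ha]; linarith)
  have e1 : ∀ z, 1 + z / a = (a + z) / a := fun z => by field_simp
  have e2 : ∀ z, 1 - z / a = (a - z) / a := fun z => by field_simp
  rw [e1, e2, e1, e2, Real.log_div hx1.ne' ha.ne', Real.log_div hx.ne' ha.ne',
    Real.log_div hy.ne' ha.ne', Real.log_div hy1.ne' ha.ne'] at key
  have l1 := Real.log_le_log (by positivity) h1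
  have l2 := Real.log_le_log (by positivity) h2
  rw [Real.log_mul hx1.ne' hk.ne', Real.log_mul hβ.ne' hy.ne'] at l1
  rw [Real.log_mul hγ.ne' hy1.ne', Real.log_mul hx.ne' hk.ne'] at l2
  have e3 : 2 / a * (p - q) = 2 * (p / a - q / a) := by ring
  rw [← Real.log_le_log_iff (by positivity) hβ, Real.log_mul (Real.exp_pos _).ne' hγ.ne',
    Real.log_exp, e3]
  linarith

/-- The Hilbert metric dominates the uniform distance of logarithmic derivatives. -/
theorem abs_logDeriv_sub_le_hilbertDist {a : ℝ} (ha : 0 < a) {φ ψ : Circ → ℝ}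
    (hφ : φ ∈ logLipCone a) (hψ : ψ ∈ logLipCone a) (t : ℝ) :
    ((2 / a * |logDeriv (fun t : ℝ => φ t) t - logDeriv (fun t : ℝ => ψ t) t| : ℝ) : EReal) ≤
      hilbertDist (logLipCone a) φ ψ := by
  obtain ⟨hφC, hφ0, hφL⟩ := (mem_logLipCone_iff ha).mp hφ
  obtain ⟨hψC, hψ0, hψL⟩ := (mem_logLipCone_iff ha).mp hψ
  set u : ℝ → ℝ := fun t => φ t with hu
  set v : ℝ → ℝ := fun t => ψ t with hv
  have hupper : ∀ β : ℝ, β • ψ - φ ∈ logLipCone a → ∀ t : ℝ, 0 < β * v t - u t ∧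
      |β * deriv v t - deriv u t| ≤ a * (β * v t - u t) := by
    intro β hβ
    have := (smul_sub_mem_logLipCone_iff ha hφC hψC β 1).mp (by rwa [one_smul])
    simpa only [one_mul] using this
  have hlower : ∀ γ : ℝ, φ - γ • ψ ∈ logLipCone a → ∀ t : ℝ, 0 < u t - γ * v t ∧
      |deriv u t - γ * deriv v t| ≤ a * (u t - γ * v t) := by
    intro γ hγ
    have := (smul_sub_mem_logLipCone_iff ha hψC hφC 1 γ).mp (by rwa [one_smul])
    simpa only [one_mul] using this
  have hk : 0 < u t / v t := div_pos (hφ0 t) (hψ0 t)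
  have hβk : ∀ β : ℝ, β • ψ - φ ∈ logLipCone a → u t / v t ≤ β := fun β hβ => by
    rw [div_le_iff₀ (hψ0 t)]
    linarith [(hupper β hβ t).1]
  have hγk : ∀ γ : ℝ, φ - γ • ψ ∈ logLipCone a → γ ≤ u t / v t := fun γ hγ => by
    rw [le_div_iff₀ (hψ0 t)]
    linarith [(hlower γ hγ t).1]
  -- Excluding `M = 0` and `m = ⊤` makes the quotient `M / m` in `[0,∞]` behave as a true quotient.
  have hM0 : hilbertUpper (logLipCone a) φ ψ ≠ 0 := by
    have : ENNReal.ofReal (u t / v t) ≤ hilbertUpper (logLipCone a) φ ψ :=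
      le_iInf₂ fun β hβ => ENNReal.ofReal_le_ofReal (hβk β hβ.2)
    exact ((ENNReal.ofReal_pos.mpr hk).trans_le this).ne'
  have hmtop : hilbertLower (logLipCone a) φ ψ ≠ ⊤ := by
    have : hilbertLower (logLipCone a) φ ψ ≤ ENNReal.ofReal (u t / v t) :=
      iSup₂_le fun γ hγ => ENNReal.ofReal_le_ofReal (hγk γ hγ.2)
    exact (this.trans_lt ENNReal.ofReal_lt_top).ne
  set K := 2 / a * |logDeriv u t - logDeriv v t| with hK
  have key : ∀ β γ : ℝ, 0 < β → β • ψ - φ ∈ logLipCone a → 0 < γ → φ - γ • ψ ∈ logLipCone a →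
      Real.exp K * γ ≤ β := by
    intro β γ hβ0 hβ hγ0 hγ
    have hγβ := (hγk γ hγ).trans (hβk β hβ)
    obtain ⟨b1, b2⟩ := abs_le.mp (hupper β hβ t).2
    obtain ⟨c1, c2⟩ := abs_le.mp (hlower γ hγ t).2
    have hp := (logDeriv_abs_le_iff (hφ0 t)).mpr (hφL t)
    have hq := (logDeriv_abs_le_iff (hψ0 t)).mpr (hψL t)
    have du : deriv u t = logDeriv u t * u t := by
      rw [logDeriv_apply, div_mul_cancel₀ _ (hφ0 t).ne']
    have dv : deriv v t = logDeriv v t * v t := by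
      rw [logDeriv_apply, div_mul_cancel₀ _ (hψ0 t).ne']
    have hku : u t = u t / v t * v t := by rw [div_mul_cancel₀ _ (hψ0 t).ne']
    rw [du, dv, hku] at b1 b2 c1 c2
    have hv0 := hψ0 t
    change 0 < v t at hv0
    rcases le_total (logDeriv v t) (logDeriv u t) with h | h
    · rw [hK, abs_of_nonneg (sub_nonneg.mpr h)]
      refine exp_mul_le_of_cone_bounds ha hp hq hk hγ0 hβ0 h hγβ ?_ ?_
      · refine le_of_mul_le_mul_right ?_ hv0
        linarith
      · refine le_of_mul_le_mul_right ?_ hv0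
        linarith
    -- The reversed order follows by the reflection `(p, q) ↦ (-p, -q)`, which preserves the cone
    -- conditions.
    · rw [hK, abs_of_nonpos (sub_nonpos.mpr h)]
      have := exp_mul_le_of_cone_bounds (p := -logDeriv u t) (q := -logDeriv v t) ha
        (by rwa [abs_neg]) (by rwa [abs_neg]) hk hγ0 hβ0 (neg_le_neg h) hγβ
        (le_of_mul_le_mul_right (by linarith) hv0) (le_of_mul_le_mul_right (by linarith) hv0)
      rwa [neg_sub_neg, ← neg_sub] at this
  have hmul : ENNReal.ofReal (Real.exp K) * hilbertLower (logLipCone a) φ ψ ≤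
      hilbertUpper (logLipCone a) φ ψ := by
    rw [hilbertLower, ENNReal.mul_iSup]
    refine iSup_le fun γ => ?_
    rw [ENNReal.mul_iSup]
    refine iSup_le fun hγ => le_iInf₂ fun β hβ => ?_
    rw [← ENNReal.ofReal_mul (Real.exp_pos _).le]
    exact ENNReal.ofReal_le_ofReal (key β γ hβ.1 hβ.2 hγ.1 hγ.2)
  have hdiv : ENNReal.ofReal (Real.exp K) ≤
      hilbertUpper (logLipCone a) φ ψ / hilbertLower (logLipCone a) φ ψ :=
    (ENNReal.le_div_iff_mul_le (Or.inr hM0) (Or.inl hmtop)).mpr hmul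
  have := ENNReal.log_monotone hdiv
  rwa [ENNReal.log_ofReal_of_pos (Real.exp_pos _), Real.log_exp] at this

/-- The pointwise bound behind `hilbertDist_le`: a large enough multiple `β v` dominates `u` in
the order of the cone. -/
theorem abs_smul_sub_le_of_bounds {a p q l u v β D : ℝ} (ha : 0 < a) (hl : l < 1)
    (hq : |q| ≤ l * a) (hpq : |p - q| ≤ D) (hu : 0 < u) (hD : 0 < D) (h : u * Real.exp (D / ((1 - l) * a)) ≤ β * v) :
    0 < β * v - u ∧ |β * (q * v) - p * u| ≤ a * (β * v - u) := by
  have hl' : 0 < (1 - l) * a := mul_pos (by linarith) ha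
  have hexp := Real.add_one_le_exp (D / ((1 - l) * a))
  have hx : 0 < D / ((1 - l) * a) := by positivity
  set x := D / ((1 - l) * a) with hxd
  have hDx : D = x * ((1 - l) * a) := by rw [hxd, div_mul_cancel₀ _ hl'.ne']
  have h1 : u * (x + 1) ≤ β * v := (mul_le_mul_of_nonneg_left hexp hu.le).trans h
  have hw : 0 < β * v - u := by nlinarith
  refine ⟨hw, ?_⟩
  -- The first term uses up the fraction `l` of the slope allowance `a`. The second is at most `D
  -- u`, and `e^x ≥ 1 + x` gives `β v - u ≥ x u` with `D = x (1 - l) a`, which fits in the rest.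
  have e : β * (q * v) - p * u = q * (β * v - u) + (q - p) * u := by ring
  rw [e]
  calc |q * (β * v - u) + (q - p) * u| ≤ |q| * (β * v - u) + D * u := by
        refine (abs_add_le _ _).trans (add_le_add ?_ ?_)
        · rw [abs_mul, abs_of_pos hw]
        · rw [abs_mul, abs_of_pos hu, abs_sub_comm]
          exact mul_le_mul_of_nonneg_right hpq hu.le
    _ ≤ l * a * (β * v - u) + (1 - l) * a * (x * u) := by
        rw [hDx]
        have := mul_le_mul_of_nonneg_right hq hw.le
        linarith
    _ ≤ l * a * (β * v - u) + (1 - l) * a * (β * v - u) := by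
        gcongr
        linarith
    _ = a * (β * v - u) := by ring

theorem periodic_coe_comp (φ : Circ → ℝ) : Function.Periodic (fun t : ℝ => φ t) 1 := fun t => by
  simp

theorem map_fract {u : ℝ → ℝ} (hu : Function.Periodic u 1) (t : ℝ) : u (Int.fract t) = u t := by
  have := hu.sub_int_mul_eq (x := t) ⌊t⌋
  rwa [mul_one] at this

/-- Densities with small logarithmic derivatives are close in the Hilbert metric if their
logarithmic derivatives are. -/
theorem hilbertDist_le {a l D : ℝ} (ha : 0 < a) (hl : l < 1) (hD : 0 < D)
    {φ ψ : Circ → ℝ} (hφ : φ ∈ logLipCone a) (hψ : ψ ∈ logLipCone a)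
    (hp : ∀ t, |logDeriv (fun t : ℝ => φ t) t| ≤ l * a)
    (hq : ∀ t, |logDeriv (fun t : ℝ => ψ t) t| ≤ l * a)
    (hpq : ∀ t, |logDeriv (fun t : ℝ => φ t) t - logDeriv (fun t : ℝ => ψ t) t| ≤ D) :
    hilbertDist (logLipCone a) φ ψ ≤ ((2 * (D + D / ((1 - l) * a)) : ℝ) : EReal) := by
  obtain ⟨hφC, hφ0, hφL⟩ := (mem_logLipCone_iff ha).mp hφ
  obtain ⟨hψC, hψ0, hψL⟩ := (mem_logLipCone_iff ha).mp hψ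
  have huP := periodic_coe_comp φ
  have hvP := periodic_coe_comp ψ
  set u : ℝ → ℝ := fun t => φ t with hu
  set v : ℝ → ℝ := fun t => ψ t with hv
  have hφ0' : ∀ t, 0 < u t := hφ0
  have hψ0' : ∀ t, 0 < v t := hψ0
  set x := D / ((1 - l) * a) with hx
  set L := Real.log (u 0) - Real.log (v 0) with hL
  have hosc : ∀ t, |(Real.log (u t) - Real.log (v t)) - L| ≤ D := by
    intro t
    -- By periodicity only a period of length 1 matters, so `log (u/v)` oscillates by at most `D`.
    have h := abs_log_sub_log_sub_le (hφC.differentiable one_ne_zero)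
      (hψC.differentiable one_ne_zero) hφ0' hψ0' hpq (Int.fract t) 0
    rw [map_fract huP, map_fract hvP, sub_zero, abs_of_nonneg (Int.fract_nonneg t)] at h
    exact h.trans (mul_le_of_le_one_right hD.le (Int.fract_lt_one t).le)
  have du : ∀ t, deriv u t = logDeriv u t * u t := fun t => by
    rw [logDeriv_apply, div_mul_cancel₀ _ (hφ0' t).ne']
  have dv : ∀ t, deriv v t = logDeriv v t * v t := fun t => by
    rw [logDeriv_apply, div_mul_cancel₀ _ (hψ0' t).ne']
  have hulog : ∀ t, u t = Real.exp (Real.log (u t)) := fun t => (Real.exp_log (hφ0' t)).symm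
  have hvlog : ∀ t, v t = Real.exp (Real.log (v t)) := fun t => (Real.exp_log (hψ0' t)).symm
  have huv : ∀ t, u t * Real.exp x ≤ Real.exp (L + (D + x)) * v t := fun t => by
    rw [hulog, hvlog, ← Real.exp_add, ← Real.exp_add, Real.exp_le_exp]
    linarith [(abs_le.mp (hosc t)).2]
  have hvu : ∀ t, Real.exp (L - (D + x)) * v t * Real.exp x ≤ 1 * u t := fun t => by
    rw [one_mul, hulog, hvlog, ← Real.exp_add, ← Real.exp_add, Real.exp_le_exp]
    linarith [(abs_le.mp (hosc t)).1]
  -- In the exponent, `D` pays for the oscillation of `log (u/v)` around `L`, and `x` for the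
  -- derivative condition.
  have hβ : Real.exp (L + (D + x)) • ψ - φ ∈ logLipCone a := by
    have := (smul_sub_mem_logLipCone_iff ha hφC hψC (Real.exp (L + (D + x))) 1).mpr fun t => by
      have := abs_smul_sub_le_of_bounds ha hl (hq t) (hpq t) (hφ0' t) hD
        (huv t)
      rw [← du, ← dv] at this
      simpa only [one_mul] using this
    rwa [one_smul] at this
  have hγ : φ - Real.exp (L - (D + x)) • ψ ∈ logLipCone a := by
    have := (smul_sub_mem_logLipCone_iff ha hψC hφC 1 (Real.exp (L - (D + x)))).mpr fun t => by
      have := abs_smul_sub_le_of_bounds (D := D)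
        ha hl (hp t) (by rw [abs_sub_comm]; exact hpq t)
        (mul_pos (Real.exp_pos _) (hψ0' t)) hD (hvu t)
      rw [mul_left_comm (logDeriv v t), ← du, ← dv] at this
      exact this
    rwa [one_smul] at this
  have hM : hilbertUpper (logLipCone a) φ ψ ≤ ENNReal.ofReal (Real.exp (L + (D + x))) :=
    iInf₂_le _ ⟨Real.exp_pos _, hβ⟩
  have hm : ENNReal.ofReal (Real.exp (L - (D + x))) ≤ hilbertLower (logLipCone a) φ ψ :=
    le_iSup₂ (f := fun (β : ℝ) (_ : 0 < β ∧ φ - β • ψ ∈ logLipCone a) => ENNReal.ofReal β)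
      _ ⟨Real.exp_pos _, hγ⟩
  have h := ENNReal.log_monotone (ENNReal.div_le_div hM hm)
  rw [← ENNReal.ofReal_div_of_pos (Real.exp_pos _), ← Real.exp_sub,
    ENNReal.log_ofReal_of_pos (Real.exp_pos _), Real.log_exp] at h
  refine h.trans_eq ?_
  congr 1
  ring

/-! ### The mean field of a density -/

/-- The mean of `cos (2πt)` with respect to the normalization of the density `u` on `[0,1]`. -/
noncomputable def meanCos (u : ℝ → ℝ) : ℝ :=
  (∫ t in (0 : ℝ)..1, Real.cos (2 * Real.pi * t) * u t) / ∫ t in (0 : ℝ)..1, u t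

theorem integral_sin_sq_two_pi : ∫ t in (0 : ℝ)..1, Real.sin (2 * Real.pi * t) ^ 2 = 1 / 2 := by
  have hpi : (2 * Real.pi) ≠ 0 := by positivity
  rw [intervalIntegral.integral_comp_mul_left (fun x => Real.sin x ^ 2) hpi, integral_sin_sq]
  simp only [mul_zero, mul_one, Real.sin_two_pi, Real.sin_zero, smul_eq_mul]
  field_simp
  ring

/-- Integration by parts; the boundary terms vanish because `sin (2πt)` does at 0 and 1. -/
theorem two_pi_mul_integral_cos_mul {u : ℝ → ℝ} (hu : ContDiff ℝ 1 u) :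
    2 * Real.pi * ∫ t in (0 : ℝ)..1, Real.cos (2 * Real.pi * t) * u t =
      -∫ t in (0 : ℝ)..1, Real.sin (2 * Real.pi * t) * deriv u t := by
  have hu' : Continuous (deriv u) := hu.continuous_deriv le_rfl
  have huc := hu.continuous
  have hd : ∀ t : ℝ, HasDerivAt (fun t => Real.sin (2 * Real.pi * t) * u t)
      (2 * Real.pi * (Real.cos (2 * Real.pi * t) * u t) +
        Real.sin (2 * Real.pi * t) * deriv u t) t := by
    intro t
    have h1 : HasDerivAt (fun t : ℝ => Real.sin (2 * Real.pi * t))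
        (Real.cos (2 * Real.pi * t) * (2 * Real.pi * 1)) t :=
      ((hasDerivAt_id t).const_mul (2 * Real.pi)).sin
    convert! h1.mul (hu.differentiable one_ne_zero t).hasDerivAt using 1
    ring
  have h := intervalIntegral.integral_eq_sub_of_hasDerivAt (a := 0) (b := 1)
    (fun t _ => hd t) (Continuous.intervalIntegrable (by fun_prop) _ _)
  rw [intervalIntegral.integral_add (Continuous.intervalIntegrable (by fun_prop) _ _)
    (Continuous.intervalIntegrable (by fun_prop) _ _), intervalIntegral.integral_const_mul] at h
  simp at h
  linarith

/-- If `log (u/v)` equals `L` somewhere, then `e^(L-D) v ≤ u ≤ e^(L+D) v` on `[0,1]`; integrating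
with equal masses gives `L - D ≤ 0 ≤ L + D`. -/
theorem abs_log_sub_log_le_of_integral_eq {u v : ℝ → ℝ} {D : ℝ} (hu : Differentiable ℝ u)
    (hv : Differentiable ℝ v) (hu0 : ∀ x, 0 < u x) (hv0 : ∀ x, 0 < v x)
    (h : ∀ x, |logDeriv u x - logDeriv v x| ≤ D)
    (hui : ∫ t in (0 : ℝ)..1, u t = 1) (hvi : ∫ t in (0 : ℝ)..1, v t = 1)
    {t : ℝ} (ht : t ∈ Icc (0 : ℝ) 1) : |Real.log (u t) - Real.log (v t)| ≤ D := by
  have hD : 0 ≤ D := (abs_nonneg _).trans (h 0)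
  set L := Real.log (u t) - Real.log (v t) with hL
  have hbd : ∀ s ∈ Icc (0 : ℝ) 1, |(Real.log (u s) - Real.log (v s)) - L| ≤ D := by
    intro s hs
    refine (abs_log_sub_log_sub_le hu hv hu0 hv0 h s t).trans (mul_le_of_le_one_right hD ?_)
    rw [abs_le]
    constructor <;> linarith [hs.1, hs.2, ht.1, ht.2]
  have hulog : ∀ t, u t = Real.exp (Real.log (u t)) := fun t => (Real.exp_log (hu0 t)).symm
  have hvlog : ∀ t, v t = Real.exp (Real.log (v t)) := fun t => (Real.exp_log (hv0 t)).symm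
  have iu : IntervalIntegrable u volume 0 1 := hu.continuous.intervalIntegrable _ _
  have iv : IntervalIntegrable v volume 0 1 := hv.continuous.intervalIntegrable _ _
  have h1 : ∫ s in (0 : ℝ)..1, Real.exp (L - D) * v s ≤ ∫ s in (0 : ℝ)..1, u s := by
    refine intervalIntegral.integral_mono_on zero_le_one (iv.const_mul _) iu fun s hs => ?_
    rw [hulog s, hvlog s, ← Real.exp_add, Real.exp_le_exp]
    linarith [(abs_le.mp (hbd s hs)).1]
  have h2 : ∫ s in (0 : ℝ)..1, u s ≤ ∫ s in (0 : ℝ)..1, Real.exp (L + D) * v s := by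
    refine intervalIntegral.integral_mono_on zero_le_one iu (iv.const_mul _) fun s hs => ?_
    rw [hulog s, hvlog s, ← Real.exp_add, Real.exp_le_exp]
    linarith [(abs_le.mp (hbd s hs)).2]
  rw [intervalIntegral.integral_const_mul, hvi, hui, mul_one] at h1 h2
  rw [Real.exp_le_one_iff] at h1
  rw [Real.one_le_exp_iff] at h2
  exact abs_le.mpr ⟨by linarith, by linarith⟩

theorem abs_sub_le_two_mul_of_abs_log_le {x y D : ℝ} (hx : 0 < x) (hy : 0 < y) (hD : D ≤ 1)
    (h : |Real.log x - Real.log y| ≤ D) : |x - y| ≤ 2 * D * y := by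
  have e : x - y = (Real.exp (Real.log x - Real.log y) - 1) * y := by
    rw [Real.exp_sub, Real.exp_log hx, Real.exp_log hy]
    field_simp
  rw [e, abs_mul, abs_of_pos hy]
  exact mul_le_mul_of_nonneg_right
    ((Real.abs_exp_sub_one_le (h.trans hD)).trans (by linarith)) hy.le

/-- After integration by parts the difference is `∫ sin (v' - u')`, where `|v' - u'|` is at most `D`
up to a factor `1 + O(a)`. What counts is then the integral of `|sin|`, whose crude bound 1 would
give a rate `(1 + 2) / 5`, too large. -/
theorem abs_integral_cos_sub_le {u v : ℝ → ℝ} {a D : ℝ} (ha : a ≤ 1 / 10000) (hDa : D ≤ 2 * a)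
    (hu : ContDiff ℝ 1 u) (hv : ContDiff ℝ 1 v) (hu0 : ∀ x, 0 < u x) (hv0 : ∀ x, 0 < v x)
    (hua : ∀ x, |logDeriv u x| ≤ a) (hva : ∀ x, |logDeriv v x| ≤ a)
    (h : ∀ x, |logDeriv u x - logDeriv v x| ≤ D)
    (hui : ∫ t in (0 : ℝ)..1, u t = 1) (hvi : ∫ t in (0 : ℝ)..1, v t = 1) :
    2 * Real.pi * |(∫ t in (0 : ℝ)..1, Real.cos (2 * Real.pi * t) * u t) -
      ∫ t in (0 : ℝ)..1, Real.cos (2 * Real.pi * t) * v t| ≤ 71 / 100 * D := by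
  have ha0 : 0 ≤ a := (abs_nonneg _).trans (hua 0)
  have hD : 0 ≤ D := (abs_nonneg _).trans (h 0)
  have hdu := hu.differentiable one_ne_zero
  have hdv := hv.differentiable one_ne_zero
  have hcu : Continuous (deriv u) := hu.continuous_deriv le_rfl
  have hcv : Continuous (deriv v) := hv.continuous_deriv le_rfl
  have hle : ∀ w : ℝ → ℝ, Differentiable ℝ w → (∀ x, 0 < w x) → (∀ x, |logDeriv w x| ≤ a) →
      (∫ t in (0 : ℝ)..1, w t = 1) → ∀ t ∈ Icc (0 : ℝ) 1, w t ≤ 1 + 2 * a := by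
    intro w hw hw0 hwa hwi t ht
    have h1 := abs_log_sub_log_le_of_integral_eq (v := fun _ => 1) (D := a) hw
      (differentiable_const _) hw0 (fun _ => one_pos) (fun x => by simpa using hwa x) hwi
      (by simp) ht
    have h2 := abs_sub_le_two_mul_of_abs_log_le (hw0 t) one_pos (by linarith) h1
    linarith [(abs_le.mp h2).2]
  have hpt : ∀ t ∈ Icc (0 : ℝ) 1, |Real.sin (2 * Real.pi * t) * (deriv v t - deriv u t)| ≤
      (1 + 2 * a) ^ 2 * D * (2 / 3 * Real.sin (2 * Real.pi * t) ^ 2 + 3 / 8) := by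
    intro t ht
    have h1 := abs_sub_le_two_mul_of_abs_log_le (hu0 t) (hv0 t) (by linarith)
      (abs_log_sub_log_le_of_integral_eq hdu hdv hu0 hv0 h hui hvi ht)
    have du : deriv u t = logDeriv u t * u t := by
      rw [logDeriv_apply, div_mul_cancel₀ _ (hu0 t).ne']
    have dv : deriv v t = logDeriv v t * v t := by
      rw [logDeriv_apply, div_mul_cancel₀ _ (hv0 t).ne']
    have e : deriv v t - deriv u t =
        -((logDeriv u t - logDeriv v t) * u t + logDeriv v t * (u t - v t)) := by
      rw [du, dv]
      ring
    have h2 : |deriv v t - deriv u t| ≤ (1 + 2 * a) ^ 2 * D := by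
      rw [e, abs_neg]
      calc _ ≤ D * u t + a * (2 * D * v t) := by
            refine (abs_add_le _ _).trans (add_le_add ?_ ?_)
            · rw [abs_mul, abs_of_pos (hu0 t)]
              exact mul_le_mul_of_nonneg_right (h t) (hu0 t).le
            · rw [abs_mul]
              exact mul_le_mul (hva t) h1 (abs_nonneg _) ha0
        _ ≤ D * (1 + 2 * a) + a * (2 * D * (1 + 2 * a)) := by
            have := hle u hdu hu0 hua hui t ht
            have := hle v hdv hv0 hva hvi t ht
            gcongr
        _ = (1 + 2 * a) ^ 2 * D := by ring
    -- This is `(2/3) (|sin| - 3/4)² ≥ 0`. The right side integrates to `1/3 + 3/8 = 17/24 < 0.709`,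
    -- which avoids integrating `|sin|`.
    have h3 : |Real.sin (2 * Real.pi * t)| ≤
        2 / 3 * Real.sin (2 * Real.pi * t) ^ 2 + 3 / 8 := by
      rw [← sq_abs (Real.sin (2 * Real.pi * t))]
      nlinarith [sq_nonneg (|Real.sin (2 * Real.pi * t)| - 3 / 4)]
    rw [abs_mul, mul_comm]
    exact mul_le_mul h2 h3 (abs_nonneg _) (by positivity)
  have e1 : 2 * Real.pi * ((∫ t in (0 : ℝ)..1, Real.cos (2 * Real.pi * t) * u t) -
      ∫ t in (0 : ℝ)..1, Real.cos (2 * Real.pi * t) * v t) =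
      ∫ t in (0 : ℝ)..1, Real.sin (2 * Real.pi * t) * (deriv v t - deriv u t) := by
    rw [mul_sub, two_pi_mul_integral_cos_mul hu, two_pi_mul_integral_cos_mul hv]
    simp only [mul_sub]
    rw [intervalIntegral.integral_sub (Continuous.intervalIntegrable (by fun_prop) _ _)
      (Continuous.intervalIntegrable (by fun_prop) _ _)]
    ring
  rw [← abs_of_pos Real.two_pi_pos, ← abs_mul, abs_of_pos Real.two_pi_pos, e1]
  refine (intervalIntegral.abs_integral_le_integral_abs zero_le_one).trans
    ((intervalIntegral.integral_mono_on zero_le_one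
      (Continuous.intervalIntegrable (by fun_prop) _ _)
      (Continuous.intervalIntegrable (by fun_prop) _ _) hpt).trans ?_)
  rw [intervalIntegral.integral_const_mul, intervalIntegral.integral_add
    (Continuous.intervalIntegrable (by fun_prop) _ _)
    (Continuous.intervalIntegrable (by fun_prop) _ _), intervalIntegral.integral_const_mul,
    integral_sin_sq_two_pi]
  simp only [intervalIntegral.integral_const, sub_zero, smul_eq_mul]
  have : (1 + 2 * a) ^ 2 ≤ 1002 / 1000 := by nlinarith
  nlinarith

theorem logDeriv_div_const {u : ℝ → ℝ} {c : ℝ} (hc : c ≠ 0) (x : ℝ) :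
    logDeriv (fun t => u t / c) x = logDeriv u x := by
  simp only [div_eq_mul_inv]
  exact logDeriv_mul_const x c⁻¹ (inv_ne_zero hc)

/-- The mean field depends Lipschitz continuously on the logarithmic derivative of the density. -/
theorem abs_meanCos_sub_le {u v : ℝ → ℝ} {a D : ℝ} (ha : a ≤ 1 / 10000) (hDa : D ≤ 2 * a)
    (hu : ContDiff ℝ 1 u) (hv : ContDiff ℝ 1 v) (hu0 : ∀ x, 0 < u x) (hv0 : ∀ x, 0 < v x)
    (hua : ∀ x, |logDeriv u x| ≤ a) (hva : ∀ x, |logDeriv v x| ≤ a)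
    (h : ∀ x, |logDeriv u x - logDeriv v x| ≤ D) :
    2 * Real.pi * |meanCos u - meanCos v| ≤ 71 / 100 * D := by
  have hI : ∀ w : ℝ → ℝ, ContDiff ℝ 1 w → (∀ x, 0 < w x) → 0 < ∫ t in (0 : ℝ)..1, w t :=
    fun w hw hw0 => intervalIntegral.intervalIntegral_pos_of_pos
      (hw.continuous.intervalIntegrable _ _) hw0 one_pos
  have hIu := hI u hu hu0
  have hIv := hI v hv hv0
  set I := ∫ t in (0 : ℝ)..1, u t with hIdef
  set K := ∫ t in (0 : ℝ)..1, v t with hKdef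
  have := abs_integral_cos_sub_le (u := fun t => u t / I) (v := fun t => v t / K) ha hDa
    (hu.div_const _) (hv.div_const _) (fun x => div_pos (hu0 x) hIu)
    (fun x => div_pos (hv0 x) hIv)
    (fun x => by rw [logDeriv_div_const hIu.ne']; exact hua x)
    (fun x => by rw [logDeriv_div_const hIv.ne']; exact hva x)
    (fun x => by rw [logDeriv_div_const hIu.ne', logDeriv_div_const hIv.ne']; exact h x)
    (by rw [intervalIntegral.integral_div, div_self hIu.ne'])
    (by rw [intervalIntegral.integral_div, div_self hIv.ne'])
  simp only [← mul_div_assoc, intervalIntegral.integral_div] at this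
  exact this

theorem meanCos_one : meanCos (fun _ => 1) = 0 := by
  have hpi : (2 * Real.pi) ≠ 0 := by positivity
  simp only [meanCos, mul_one]
  rw [intervalIntegral.integral_comp_mul_left (fun x => Real.cos x) hpi]
  simp

theorem abs_meanCos_le {u : ℝ → ℝ} {a : ℝ} (ha : a ≤ 1 / 10000) (hu : ContDiff ℝ 1 u)
    (hu0 : ∀ x, 0 < u x) (hua : ∀ x, |logDeriv u x| ≤ a) :
    2 * Real.pi * |meanCos u| ≤ 71 / 100 * a := by
  have ha0 : 0 ≤ a := (abs_nonneg _).trans (hua 0)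
  have := abs_meanCos_sub_le (v := fun _ => 1) (D := a) ha (by linarith) hu contDiff_const hu0
    (fun _ => one_pos) hua (fun x => by simpa using ha0) (fun x => by simpa using hua x)
  rwa [meanCos_one, sub_zero] at this

theorem cosMean_densityMeasure {φ : Circ → ℝ} (hφ : Continuous φ) (h0 : ∀ x, 0 ≤ φ x) :
    cosMean (densityMeasure φ) = meanCos (fun t => φ t) := by
  have hm : Measurable fun x => (φ x).toNNReal := hφ.measurable.real_toNNReal
  have e : densityMeasure φ = volume.withDensity fun x => (((φ x).toNNReal : NNReal) : ℝ≥0∞) := rfl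
  have hint : ∀ g : Circ → ℝ, ∫ x, g x ∂(densityMeasure φ) = ∫ t in (0 : ℝ)..1, g t * φ t := by
    intro g
    rw [e, integral_withDensity_eq_integral_smul hm]
    have := UnitAddCircle.intervalIntegral_preimage 0 (fun x : Circ => g x * φ x)
    rw [zero_add] at this
    rw [this]
    refine integral_congr_ae (Eventually.of_forall fun x => ?_)
    simp only [NNReal.smul_def, Real.coe_toNNReal _ (h0 x), smul_eq_mul, mul_comm]
  have hone : (densityMeasure φ).real univ = ∫ t in (0 : ℝ)..1, φ t := by
    have := hint fun _ => 1
    simpa using this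
  rw [cosMean, average_eq, hint, hone, meanCos, smul_eq_mul, inv_mul_eq_div]
  simp only [Function.Periodic.lift_coe]

/-! ### The covering map and its inverse branch -/

/-- The lift to `ℝ` of `f ∘ g_μ`, where `s` is the strength of the mean field. -/
noncomputable def coverLift (s x : ℝ) : ℝ := 5 * (x + s * Real.sin (2 * Real.pi * x))

/-- The derivative of `x ↦ x + s sin (2πx)`. -/
noncomputable def couplingDeriv (s x : ℝ) : ℝ := 1 + 2 * Real.pi * s * Real.cos (2 * Real.pi * x)

/-- The inverse of `coverLift s`. -/
noncomputable def coverInv (s : ℝ) : ℝ → ℝ := Function.invFun (coverLift s)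

theorem hasDerivAt_sin_two_pi (x : ℝ) : HasDerivAt (fun x : ℝ => Real.sin (2 * Real.pi * x))
    (2 * Real.pi * Real.cos (2 * Real.pi * x)) x := by
  convert! ((hasDerivAt_id x).const_mul (2 * Real.pi)).sin using 1
  simp only [id]
  ring

theorem hasDerivAt_cos_two_pi (x : ℝ) : HasDerivAt (fun x : ℝ => Real.cos (2 * Real.pi * x))
    (-(2 * Real.pi * Real.sin (2 * Real.pi * x))) x := by
  convert! ((hasDerivAt_id x).const_mul (2 * Real.pi)).cos using 1
  simp only [id]
  ring

theorem abs_sin_two_pi_sub_le (x y : ℝ) :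
    |Real.sin (2 * Real.pi * x) - Real.sin (2 * Real.pi * y)| ≤ 2 * Real.pi * |x - y| := by
  refine Convex.norm_image_sub_le_of_norm_hasDerivWithin_le (s := univ)
    (fun x _ => (hasDerivAt_sin_two_pi x).hasDerivWithinAt) (fun x _ => ?_) convex_univ
    (mem_univ y) (mem_univ x)
  rw [Real.norm_eq_abs, abs_mul, abs_of_pos Real.two_pi_pos]
  exact mul_le_of_le_one_right Real.two_pi_pos.le (Real.abs_cos_le_one _)

theorem abs_cos_two_pi_sub_le (x y : ℝ) :
    |Real.cos (2 * Real.pi * x) - Real.cos (2 * Real.pi * y)| ≤ 2 * Real.pi * |x - y| := by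
  refine Convex.norm_image_sub_le_of_norm_hasDerivWithin_le (s := univ)
    (fun x _ => (hasDerivAt_cos_two_pi x).hasDerivWithinAt) (fun x _ => ?_) convex_univ
    (mem_univ y) (mem_univ x)
  rw [Real.norm_eq_abs, abs_neg, abs_mul, abs_of_pos Real.two_pi_pos]
  exact mul_le_of_le_one_right Real.two_pi_pos.le (Real.abs_sin_le_one _)

theorem hasDerivAt_coverLift (s x : ℝ) :
    HasDerivAt (coverLift s) (5 * couplingDeriv s x) x := by
  have := ((hasDerivAt_id x).add ((hasDerivAt_sin_two_pi x).const_mul s)).const_mul 5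
  convert! this using 1
  rw [couplingDeriv]
  ring

theorem hasDerivAt_couplingDeriv (s x : ℝ) : HasDerivAt (couplingDeriv s)
    (-(4 * Real.pi ^ 2 * s * Real.sin (2 * Real.pi * x))) x := by
  convert! ((hasDerivAt_cos_two_pi x).const_mul (2 * Real.pi * s)).const_add 1 using 1
  ring

theorem contDiff_couplingDeriv (s : ℝ) {n : ℕ∞} : ContDiff ℝ n (couplingDeriv s) := by
  unfold couplingDeriv
  fun_prop

theorem coverLift_zero (s : ℝ) : coverLift s 0 = 0 := by simp [coverLift]

theorem coverLift_add_one (s x : ℝ) : coverLift s (x + 1) = coverLift s x + 5 := by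
  have h : Real.sin (2 * Real.pi * (x + 1)) = Real.sin (2 * Real.pi * x) := sin_two_pi_periodic x
  rw [coverLift, coverLift, h]
  ring

theorem couplingDeriv_add_one (s x : ℝ) : couplingDeriv s (x + 1) = couplingDeriv s x := by
  have h : Real.cos (2 * Real.pi * (x + 1)) = Real.cos (2 * Real.pi * x) := cos_two_pi_periodic x
  rw [couplingDeriv, couplingDeriv, h]

theorem abs_couplingDeriv_sub_one_le (s x : ℝ) :
    |couplingDeriv s x - 1| ≤ 2 * Real.pi * |s| := by
  rw [couplingDeriv, add_sub_cancel_left, abs_mul, abs_mul, abs_of_pos Real.two_pi_pos]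
  exact mul_le_of_le_one_right (by positivity) (Real.abs_cos_le_one _)

section Inverse

variable {s : ℝ} (hs : 2 * Real.pi * |s| ≤ 1 / 2)
include hs

theorem couplingDeriv_pos (x : ℝ) : 0 < couplingDeriv s x := by
  linarith [(abs_le.mp ((abs_couplingDeriv_sub_one_le s x).trans hs)).1]

theorem abs_sub_le_abs_coverLift_sub (x y : ℝ) : |x - y| ≤ |coverLift s x - coverLift s y| := by
  have h := abs_sin_two_pi_sub_le x y
  have e : coverLift s x - coverLift s y = 5 * ((x - y) -
      (-(s * (Real.sin (2 * Real.pi * x) - Real.sin (2 * Real.pi * y))))) := by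
    rw [coverLift, coverLift]
    ring
  rw [e, abs_mul, abs_of_pos (by norm_num : (0 : ℝ) < 5)]
  have h1 := abs_sub_abs_le_abs_sub (x - y)
    (-(s * (Real.sin (2 * Real.pi * x) - Real.sin (2 * Real.pi * y))))
  rw [abs_neg, abs_mul] at h1
  have h2 : |s| * |Real.sin (2 * Real.pi * x) - Real.sin (2 * Real.pi * y)| ≤ 1 / 2 * |x - y| := by
    calc _ ≤ |s| * (2 * Real.pi * |x - y|) := by gcongr
      _ = 2 * Real.pi * |s| * |x - y| := by ring
      _ ≤ _ := by gcongr
  have := abs_nonneg (x - y)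
  linarith

theorem coverLift_injective : Function.Injective (coverLift s) := fun x y hxy => by
  have := abs_sub_le_abs_coverLift_sub hs x y
  rw [hxy, sub_self, abs_zero] at this
  exact sub_eq_zero.mp (abs_nonpos_iff.mp this)

theorem coverLift_surjective : Function.Surjective (coverLift s) := fun z => by
  have hc : Continuous (coverLift s) := by
    unfold coverLift
    fun_prop
  have hb : ∀ x, |s * Real.sin (2 * Real.pi * x)| ≤ 1 := fun x => by
    rw [abs_mul]
    have hs1 : |s| ≤ 1 := by
      have := Real.pi_gt_three
      nlinarith [abs_nonneg s]
    exact mul_le_one₀ hs1 (abs_nonneg _) (Real.abs_sin_le_one _)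
  refine mem_range_of_exists_le_of_exists_ge hc ⟨z / 5 - 1, ?_⟩ ⟨z / 5 + 1, ?_⟩
  · have := (abs_le.mp (hb (z / 5 - 1))).2
    rw [coverLift]
    linarith
  · have := (abs_le.mp (hb (z / 5 + 1))).1
    rw [coverLift]
    linarith

theorem coverLift_coverInv (z : ℝ) : coverLift s (coverInv s z) = z :=
  Function.rightInverse_invFun (coverLift_surjective hs) z

theorem coverInv_coverLift (x : ℝ) : coverInv s (coverLift s x) = x :=
  Function.leftInverse_invFun (coverLift_injective hs) x

theorem coverInv_add_five (z : ℝ) : coverInv s (z + 5) = coverInv s z + 1 := by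
  rw [← coverInv_coverLift hs (coverInv s z + 1), coverLift_add_one, coverLift_coverInv hs]

theorem continuous_coverInv : Continuous (coverInv s) := by
  refine (LipschitzWith.of_dist_le_mul (K := 1) fun x y => ?_).continuous
  have := abs_sub_le_abs_coverLift_sub hs (coverInv s x) (coverInv s y)
  rw [coverLift_coverInv hs, coverLift_coverInv hs] at this
  simpa [Real.dist_eq] using this

theorem hasDerivAt_coverInv (z : ℝ) :
    HasDerivAt (coverInv s) (5 * couplingDeriv s (coverInv s z))⁻¹ z :=
  HasDerivAt.of_local_left_inverse (continuous_coverInv hs).continuousAt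
    (hasDerivAt_coverLift s _) (mul_pos (by norm_num) (couplingDeriv_pos hs _)).ne'
    (Eventually.of_forall (coverLift_coverInv hs))

/-- Bootstrap: the derivative is a smooth expression in `coverInv s` itself, so continuity gives
`C¹` and then `C²`. -/
theorem contDiff_coverInv : ContDiff ℝ 2 (coverInv s) := by
  have hd : Differentiable ℝ (coverInv s) := fun z => (hasDerivAt_coverInv hs z).differentiableAt
  have hder : deriv (coverInv s) = fun z => (5 * couplingDeriv s (coverInv s z))⁻¹ :=
    funext fun z => (hasDerivAt_coverInv hs z).deriv
  have hne : ∀ z, 5 * couplingDeriv s (coverInv s z) ≠ 0 := fun z =>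
    (mul_pos (by norm_num) (couplingDeriv_pos hs _)).ne'
  have h1 : ContDiff ℝ 1 (coverInv s) := by
    rw [contDiff_one_iff_deriv, hder]
    exact ⟨hd, (continuous_const.mul (((contDiff_couplingDeriv s (n := 0)).continuous).comp
      (continuous_coverInv hs))).inv₀ hne⟩
  rw [show (2 : WithTop ℕ∞) = 1 + 1 from rfl, contDiff_succ_iff_deriv]
  refine ⟨hd, by simp, ?_⟩
  rw [hder]
  exact (contDiff_const.mul ((contDiff_couplingDeriv s (n := 1)).comp h1)).inv hne

end Inverse

/-! ### The transfer operator with frozen mean field -/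

/-- The contribution of the inverse branch `coverInv s` to the transported density. -/
noncomputable def branchDensity (s : ℝ) (u : ℝ → ℝ) (z : ℝ) : ℝ :=
  u (coverInv s z) / (5 * couplingDeriv s (coverInv s z))

/-- The density of the image of `u` under `coverLift s`. -/
noncomputable def transfer (s : ℝ) (u : ℝ → ℝ) (z : ℝ) : ℝ :=
  ∑ k ∈ Finset.range 5, branchDensity s u (z + k)

/-- `g'' / g'` for `g x = x + s sin (2πx)`, up to sign. -/
noncomputable def distortion (s x : ℝ) : ℝ :=
  4 * Real.pi ^ 2 * s * Real.sin (2 * Real.pi * x) / couplingDeriv s x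

/-- The logarithmic derivative of `branchDensity s u`, in the coordinate `x = coverInv s z` and up
to the factor `5`. -/
noncomputable def branchRate (s : ℝ) (u : ℝ → ℝ) (x : ℝ) : ℝ :=
  (logDeriv u x + distortion s x) / couplingDeriv s x

section Transfer

variable {s : ℝ} {u : ℝ → ℝ} (hs : 2 * Real.pi * |s| ≤ 1 / 2)
include hs

theorem branchDensity_pos (hu0 : ∀ x, 0 < u x) (z : ℝ) : 0 < branchDensity s u z :=
  div_pos (hu0 _) (mul_pos (by norm_num) (couplingDeriv_pos hs _))

theorem transfer_pos (hu0 : ∀ x, 0 < u x) (z : ℝ) : 0 < transfer s u z :=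
  Finset.sum_pos (fun _ _ => branchDensity_pos hs hu0 _) (by simp)

theorem branchDensity_add_five (hu : Function.Periodic u 1) (z : ℝ) :
    branchDensity s u (z + 5) = branchDensity s u z := by
  rw [branchDensity, coverInv_add_five hs, hu, couplingDeriv_add_one, branchDensity]

/-- A shift by 1 permutes the five branches cyclically, since `branchDensity` has period 5. -/
theorem transfer_periodic (hu : Function.Periodic u 1) : Function.Periodic (transfer s u) 1 := by
  intro z
  have h := branchDensity_add_five hs hu z
  simp only [transfer, Finset.sum_range_succ, Finset.sum_range_zero]
  push_cast
  rw [add_assoc z 1 0, add_assoc z 1 1, add_assoc z 1 2, add_assoc z 1 3, add_assoc z 1 4]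
  norm_num
  rw [h]
  ring

theorem contDiff_branchDensity (hu : ContDiff ℝ 2 u) : ContDiff ℝ 2 (branchDensity s u) :=
  (hu.comp (contDiff_coverInv hs)).div
    (contDiff_const.mul ((contDiff_couplingDeriv s (n := 2)).comp (contDiff_coverInv hs)))
    fun _ => (mul_pos (by norm_num) (couplingDeriv_pos hs _)).ne'

theorem contDiff_transfer (hu : ContDiff ℝ 2 u) : ContDiff ℝ 2 (transfer s u) :=
  ContDiff.sum fun _ _ => (contDiff_branchDensity hs hu).comp (contDiff_id.add contDiff_const)

theorem hasDerivAt_branchDensity (hu : Differentiable ℝ u) (hu0 : ∀ x, 0 < u x) (z : ℝ) :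
    HasDerivAt (branchDensity s u)
      (branchDensity s u z * (branchRate s u (coverInv s z) / 5)) z := by
  have hb := (couplingDeriv_pos hs (coverInv s z)).ne'
  have h := ((hu (coverInv s z)).hasDerivAt.comp z (hasDerivAt_coverInv hs z)).div
    (((hasDerivAt_couplingDeriv s (coverInv s z)).comp z (hasDerivAt_coverInv hs z)).const_mul 5)
    (mul_ne_zero (by norm_num) hb)
  convert! h using 1
  have := (hu0 (coverInv s z)).ne'
  simp only [branchDensity, branchRate, distortion, logDeriv_apply, Function.comp]
  field_simp
  ring

theorem hasDerivAt_branchRate (hu : ContDiff ℝ 2 u) (hu0 : ∀ x, 0 < u x) (x : ℝ) :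
    HasDerivAt (branchRate s u) ((deriv (deriv u) x / u x - logDeriv u x ^ 2 +
      8 * Real.pi ^ 3 * s * Real.cos (2 * Real.pi * x) / couplingDeriv s x +
      2 * distortion s x ^ 2 + logDeriv u x * distortion s x) / couplingDeriv s x) x := by
  have hb := (couplingDeriv_pos hs x).ne'
  have hx := (hu0 x).ne'
  have hu1 : ContDiff ℝ 1 (deriv u) := ((contDiff_succ_iff_deriv (n := 1)).mp hu).2.2
  have h1 := ((hu1.differentiable one_ne_zero x).hasDerivAt).div
    (hu.differentiable two_ne_zero x).hasDerivAt hx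
  have h2 := ((hasDerivAt_sin_two_pi x).const_mul (4 * Real.pi ^ 2 * s)).div
    (hasDerivAt_couplingDeriv s x) hb
  have h := (h1.add h2).div (hasDerivAt_couplingDeriv s x) hb
  convert! h using 1
  simp only [distortion, logDeriv_apply, Pi.add_apply, Pi.div_apply]
  field_simp
  ring

theorem hasDerivAt_transfer (hu : Differentiable ℝ u) (hu0 : ∀ x, 0 < u x) (z : ℝ) :
    HasDerivAt (transfer s u) (∑ k ∈ Finset.range 5,
      branchDensity s u (z + k) * (branchRate s u (coverInv s (z + k)) / 5)) z :=
  HasDerivAt.fun_sum fun k _ =>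
    (hasDerivAt_branchDensity hs hu hu0 (z + k)).comp_add_const z k

theorem logDeriv_branchDensity (hu : Differentiable ℝ u) (hu0 : ∀ x, 0 < u x) (z : ℝ) :
    logDeriv (branchDensity s u) z = branchRate s u (coverInv s z) / 5 := by
  rw [logDeriv_apply, (hasDerivAt_branchDensity hs hu hu0 z).deriv,
    mul_div_cancel_left₀ _ (branchDensity_pos hs hu0 z).ne']

/-- The logarithmic derivative of a sum is the average of those of its terms, weighted by the terms.
-/
theorem logDeriv_transfer (hu : Differentiable ℝ u) (hu0 : ∀ x, 0 < u x) (z : ℝ) :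
    logDeriv (transfer s u) z = (∑ k ∈ Finset.range 5,
      branchDensity s u (z + k) * branchRate s u (coverInv s (z + k))) /
      (∑ k ∈ Finset.range 5, branchDensity s u (z + k)) / 5 := by
  rw [logDeriv_apply, (hasDerivAt_transfer hs hu hu0 z).deriv, transfer, div_right_comm,
    Finset.sum_div _ _ 5]
  simp only [mul_div_assoc]

/-- A branch `W` with rate `ρ` satisfies `W' = W ρ / 5`, hence `W'' = W (ρ² + ρ'/g') / 25`, and `g'
≥ 1/2`. The factor `1/25` is what preserves the second cone. -/
theorem abs_deriv_deriv_transfer_le (hu : ContDiff ℝ 2 u) (hu0 : ∀ x, 0 < u x) {R R' : ℝ}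
    (hR : ∀ x, |branchRate s u x| ≤ R) (hR' : ∀ x, |deriv (branchRate s u) x| ≤ R') (z : ℝ) :
    |deriv (deriv (transfer s u)) z| ≤ (R ^ 2 + 2 * R') / 25 * transfer s u z := by
  have hdu := hu.differentiable two_ne_zero
  have hder : deriv (transfer s u) = fun z => ∑ k ∈ Finset.range 5,
      branchDensity s u (z + k) * (branchRate s u (coverInv s (z + k)) / 5) :=
    funext fun z => (hasDerivAt_transfer hs hdu hu0 z).deriv
  have hW : ∀ w, HasDerivAt (fun w => branchDensity s u w * (branchRate s u (coverInv s w) / 5))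
      (branchDensity s u w * ((branchRate s u (coverInv s w)) ^ 2 +
        deriv (branchRate s u) (coverInv s w) / couplingDeriv s (coverInv s w)) / 25) w := by
    intro w
    have hb := (couplingDeriv_pos hs (coverInv s w)).ne'
    have h := (hasDerivAt_branchDensity hs hdu hu0 w).mul
      (((hasDerivAt_branchRate hs hu hu0 (coverInv s w)).differentiableAt.hasDerivAt.comp w
        (hasDerivAt_coverInv hs w)).div_const 5)
    convert! h using 1
    simp only [Function.comp]
    field_simp
    ring
  have hT := HasDerivAt.fun_sum (u := Finset.range 5) fun k _ => (hW (z + k)).comp_add_const z k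
  rw [hder, hT.deriv, transfer, Finset.mul_sum]
  refine (Finset.abs_sum_le_sum_abs _ _).trans (Finset.sum_le_sum fun k _ => ?_)
  have hpos := branchDensity_pos hs hu0 (z + k)
  have hb := couplingDeriv_pos hs (coverInv s (z + k))
  have hb2 : 1 / 2 ≤ couplingDeriv s (coverInv s (z + k)) := by
    linarith [(abs_le.mp ((abs_couplingDeriv_sub_one_le s (coverInv s (z + k))).trans hs)).1]
  have hR'0 := (abs_nonneg _).trans (hR' 0)
  have h1 : |deriv (branchRate s u) (coverInv s (z + k)) /
      couplingDeriv s (coverInv s (z + k))| ≤ 2 * R' := by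
    rw [abs_div, abs_of_pos hb, div_le_iff₀ hb]
    nlinarith [hR' (coverInv s (z + k))]
  have h2 : |branchRate s u (coverInv s (z + k)) ^ 2| ≤ R ^ 2 := by
    rw [abs_pow]
    exact pow_le_pow_left₀ (abs_nonneg _) (hR _) 2
  rw [abs_div, abs_mul, abs_of_pos hpos, abs_of_pos (by norm_num : (0 : ℝ) < 25), div_mul_eq_mul_div,
    mul_comm (branchDensity s u (z + k))]
  gcongr
  exact (abs_add_le _ _).trans (add_le_add h2 h1)

end Transfer

/-! ### Uniform estimates for densities close to constants -/

/-- Positive `C²` densities on the circle, lifted to `ℝ`, in the two cones with parameters `a`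
and `100 a`. -/
structure IsNearlyConstant (a : ℝ) (u : ℝ → ℝ) : Prop where
  contDiff : ContDiff ℝ 2 u
  periodic : Function.Periodic u 1
  pos : ∀ x, 0 < u x
  abs_logDeriv_le : ∀ x, |logDeriv u x| ≤ a
  abs_deriv_deriv_le : ∀ x, |deriv (deriv u) x| ≤ 100 * a * u x

theorem IsNearlyConstant.differentiable {a : ℝ} {u : ℝ → ℝ} (h : IsNearlyConstant a u) :
    Differentiable ℝ u := h.contDiff.differentiable two_ne_zero

theorem IsNearlyConstant.contDiff_one {a : ℝ} {u : ℝ → ℝ} (h : IsNearlyConstant a u) :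
    ContDiff ℝ 1 u := h.contDiff.of_le one_le_two

theorem IsNearlyConstant.nonneg {a : ℝ} {u : ℝ → ℝ} (h : IsNearlyConstant a u) : 0 ≤ a :=
  (abs_nonneg _).trans (h.abs_logDeriv_le 0)

theorem isNearlyConstant_one {a : ℝ} (ha : 0 ≤ a) : IsNearlyConstant a fun _ => 1 where
  contDiff := contDiff_const
  periodic := fun _ => rfl
  pos := fun _ => one_pos
  abs_logDeriv_le := fun x => by simpa using ha
  abs_deriv_deriv_le := fun x => by simpa using ha

/-- `(log u)'' = u''/u - ((log u)')²` is at most `100 a + a²`. -/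
theorem IsNearlyConstant.abs_logDeriv_sub_le {a : ℝ} {u : ℝ → ℝ} (h : IsNearlyConstant a u)
    (ha : a ≤ 1) (x y : ℝ) : |logDeriv u x - logDeriv u y| ≤ 101 * a * |x - y| := by
  have hu1 : ContDiff ℝ 1 (deriv u) := ((contDiff_succ_iff_deriv (n := 1)).mp h.contDiff).2.2
  have hd : ∀ x, HasDerivAt (logDeriv u) (deriv (deriv u) x / u x - logDeriv u x ^ 2) x := by
    intro x
    have hx := (h.pos x).ne'
    convert! ((hu1.differentiable one_ne_zero x).hasDerivAt).div (h.differentiable x).hasDerivAt hx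
      using 1
    rw [logDeriv_apply]
    field_simp
  refine Convex.norm_image_sub_le_of_norm_hasDerivWithin_le (s := univ)
    (fun x _ => (hd x).hasDerivWithinAt) (fun x _ => ?_) convex_univ (mem_univ y) (mem_univ x)
  have ha0 := h.nonneg
  have h1 : |deriv (deriv u) x / u x| ≤ 100 * a := by
    rw [abs_div, abs_of_pos (h.pos x), div_le_iff₀ (h.pos x)]
    exact h.abs_deriv_deriv_le x
  have h2 : |logDeriv u x ^ 2| ≤ a := by
    rw [abs_pow]
    have := pow_le_pow_left₀ (abs_nonneg _) (h.abs_logDeriv_le x) 2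
    nlinarith
  exact (abs_sub _ _).trans (by linarith)

theorem inv_le_of_abs_sub_one_le {a b : ℝ} (ha : a ≤ 1 / 2) (hb : |b - 1| ≤ a) :
    0 < b ∧ b⁻¹ ≤ 1 + 2 * a := by
  have h1 := (abs_le.mp hb).1
  have ha0 := (abs_nonneg _).trans hb
  have hb0 : 0 < b := by linarith
  refine ⟨hb0, ?_⟩
  rw [inv_le_iff_one_le_mul₀ hb0]
  nlinarith

theorem abs_div_sub_div_le {a b b' X Y : ℝ} (ha : a ≤ 1 / 10) (hb : |b - 1| ≤ a)
    (hb' : |b' - 1| ≤ a) :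
    |X / b - Y / b'| ≤ (1 + 2 * a) * |X - Y| + 2 * |Y| * |b - b'| := by
  obtain ⟨h0, h1⟩ := inv_le_of_abs_sub_one_le (by linarith) hb
  obtain ⟨h0', h1'⟩ := inv_le_of_abs_sub_one_le (by linarith) hb'
  have e : X / b - Y / b' = b⁻¹ * (X - Y) + b⁻¹ * b'⁻¹ * Y * (b' - b) := by
    field_simp
    ring
  have hi := inv_pos.mpr h0
  have hi' := inv_pos.mpr h0'
  have h2 : b⁻¹ * b'⁻¹ ≤ 2 := by
    have ha0 := (abs_nonneg _).trans hb
    nlinarith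
  rw [e]
  refine (abs_add_le _ _).trans (add_le_add ?_ ?_)
  · rw [abs_mul, abs_of_pos hi]
    gcongr
  · rw [abs_mul, abs_mul, abs_of_pos (mul_pos hi hi'), abs_sub_comm b' b]
    gcongr

/-- Comparison of two values of `branchRate`, in terms of the quantities that enter it. -/
theorem abs_rate_sub_le {a D p q q' b b' A A' S S' : ℝ} (ha : a ≤ 1 / 1000000) (hq' : |q'| ≤ a)
    (hpq : |p - q| ≤ D) (hqq : |q - q'| ≤ 10 * a * D) (hb : |b - 1| ≤ a) (hb' : |b' - 1| ≤ a)
    (hbb : |b - b'| ≤ D) (hA' : |A'| ≤ 2 * a) (hAA : |A - A'| ≤ 142 / 100 * D) (hS : |S| ≤ 1)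
    (hS' : |S'| ≤ 1) (hSS : |S - S'| ≤ D) :
    |(p + A * S / b) / b - (q' + A' * S' / b') / b'| ≤ 243 / 100 * D := by
  have ha0 := (abs_nonneg _).trans hq'
  have hD := (abs_nonneg _).trans hpq
  have hAS : |A' * S'| ≤ 2 * a := by
    rw [abs_mul]
    exact (mul_le_of_le_one_right (abs_nonneg _) hS').trans hA'
  have h1 : |A * S - A' * S'| ≤ (142 / 100 + 2 * a) * D := by
    have e : A * S - A' * S' = (A - A') * S + A' * (S - S') := by ring
    rw [e]
    refine (abs_add_le _ _).trans ?_
    rw [abs_mul, abs_mul, add_mul]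
    exact add_le_add ((mul_le_of_le_one_right (abs_nonneg _) hS).trans hAA)
      (mul_le_mul hA' hSS (abs_nonneg _) (by linarith))
  have h2 : |A * S / b - A' * S' / b'| ≤ (1 + 2 * a) * ((142 / 100 + 2 * a) * D) +
      2 * (2 * a) * D := (abs_div_sub_div_le (by linarith) hb hb').trans (by gcongr)
  have h3 : |A' * S' / b'| ≤ 3 * a := by
    obtain ⟨h0, h1⟩ := inv_le_of_abs_sub_one_le (by linarith) hb'
    rw [abs_div, div_eq_mul_inv, abs_of_pos h0]
    calc |A' * S'| * b'⁻¹ ≤ 2 * a * (1 + 2 * a) := by gcongr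
      _ ≤ 3 * a := by nlinarith
  have h4 : |q' + A' * S' / b'| ≤ 4 * a := (abs_add_le _ _).trans (by linarith)
  -- The main part is `1 + 1.42`, from the logarithmic derivative and the distortion; all else is
  -- `O(a) D`.
  have h5 : |(p + A * S / b) - (q' + A' * S' / b')| ≤ 2421 / 1000 * D := by
    have e : (p + A * S / b) - (q' + A' * S' / b') =
        ((p - q) + (q - q')) + (A * S / b - A' * S' / b') := by ring
    rw [e]
    have h6 : (1 + 2 * a) * ((142 / 100 + 2 * a) * D) + 2 * (2 * a) * D + 10 * a * D ≤
        1421 / 1000 * D := by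
      have : (1 + 2 * a) * (142 / 100 + 2 * a) + 2 * (2 * a) + 10 * a ≤ 1421 / 1000 := by nlinarith
      calc _ = ((1 + 2 * a) * (142 / 100 + 2 * a) + 2 * (2 * a) + 10 * a) * D := by ring
        _ ≤ _ := by gcongr
    have := abs_add_le ((p - q) + (q - q')) (A * S / b - A' * S' / b')
    have := abs_add_le (p - q) (q - q')
    linarith
  calc _ ≤ (1 + 2 * a) * (2421 / 1000 * D) + 2 * (4 * a) * D :=
        (abs_div_sub_div_le (by linarith) hb hb').trans (by gcongr)
    _ = ((1 + 2 * a) * (2421 / 1000) + 2 * (4 * a)) * D := by ring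
    _ ≤ 243 / 100 * D := by
        gcongr
        linarith

theorem abs_couplingDeriv_sub_one_le_of_le {a s : ℝ} (hs : 4 * Real.pi ^ 2 * |s| ≤ 2 * a) (x : ℝ) :
    |couplingDeriv s x - 1| ≤ a := by
  refine (abs_couplingDeriv_sub_one_le s x).trans ?_
  have := Real.pi_gt_three
  have h : 0 ≤ Real.pi * |s| := by positivity
  nlinarith

theorem abs_distortion_le {a s : ℝ} (ha : a ≤ 1 / 1000000) (hs : 4 * Real.pi ^ 2 * |s| ≤ 2 * a)
    (x : ℝ) : |distortion s x| ≤ 3 * a := by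
  have hb := abs_couplingDeriv_sub_one_le_of_le hs x
  have ha0 := (abs_nonneg _).trans hb
  obtain ⟨h0, h1⟩ := inv_le_of_abs_sub_one_le (by linarith) hb
  have h2 : |4 * Real.pi ^ 2 * s * Real.sin (2 * Real.pi * x)| ≤ 2 * a := by
    rw [abs_mul, abs_mul, abs_of_pos (by positivity : 0 < 4 * Real.pi ^ 2)]
    exact (mul_le_of_le_one_right (by positivity) (Real.abs_sin_le_one _)).trans hs
  rw [distortion, abs_div, div_eq_mul_inv, abs_of_pos h0]
  calc _ ≤ 2 * a * (1 + 2 * a) := by gcongr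
    _ ≤ 3 * a := by nlinarith

section Rate

variable {a s : ℝ} {u : ℝ → ℝ}

theorem IsNearlyConstant.abs_branchRate_le (hu : IsNearlyConstant a u) (ha : a ≤ 1 / 1000000)
    (hs : 4 * Real.pi ^ 2 * |s| ≤ 2 * a) (x : ℝ) : |branchRate s u x| ≤ 5 * a := by
  have ha0 := hu.nonneg
  obtain ⟨h0, h1⟩ := inv_le_of_abs_sub_one_le (by linarith)
    (abs_couplingDeriv_sub_one_le_of_le hs x)
  have h2 : |logDeriv u x + distortion s x| ≤ 4 * a :=
    (abs_add_le _ _).trans (by linarith [hu.abs_logDeriv_le x, abs_distortion_le ha hs x])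
  rw [branchRate, abs_div, div_eq_mul_inv, abs_of_pos h0]
  calc _ ≤ 4 * a * (1 + 2 * a) := by gcongr
    _ ≤ 5 * a := by nlinarith

theorem two_pi_mul_abs_le_half (ha : a ≤ 1 / 1000000) (hs : 4 * Real.pi ^ 2 * |s| ≤ 2 * a) :
    2 * Real.pi * |s| ≤ 1 / 2 := by
  have := Real.pi_gt_three
  have h : 0 ≤ Real.pi * |s| := by positivity
  nlinarith

theorem IsNearlyConstant.abs_deriv_branchRate_le (hu : IsNearlyConstant a u)
    (ha : a ≤ 1 / 1000000) (hs : 4 * Real.pi ^ 2 * |s| ≤ 2 * a) (x : ℝ) :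
    |deriv (branchRate s u) x| ≤ 150 * a := by
  have ha0 := hu.nonneg
  rw [(hasDerivAt_branchRate (two_pi_mul_abs_le_half ha hs) hu.contDiff hu.pos x).deriv]
  obtain ⟨h0, h1⟩ := inv_le_of_abs_sub_one_le (by linarith)
    (abs_couplingDeriv_sub_one_le_of_le hs x)
  have hd := abs_distortion_le ha hs x
  have hp := hu.abs_logDeriv_le x
  have t1 : |deriv (deriv u) x / u x| ≤ 100 * a := by
    rw [abs_div, abs_of_pos (hu.pos x), div_le_iff₀ (hu.pos x)]
    exact hu.abs_deriv_deriv_le x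
  have t2 : |logDeriv u x ^ 2| ≤ a := by
    rw [abs_pow]
    have := pow_le_pow_left₀ (abs_nonneg _) hp 2
    nlinarith
  have t3 : |8 * Real.pi ^ 3 * s * Real.cos (2 * Real.pi * x) / couplingDeriv s x| ≤ 20 * a := by
    rw [abs_div, div_eq_mul_inv, abs_of_pos h0]
    have : |8 * Real.pi ^ 3 * s * Real.cos (2 * Real.pi * x)| ≤ 16 * a := by
      rw [abs_mul, abs_mul, abs_of_pos (by positivity : 0 < 8 * Real.pi ^ 3)]
      refine (mul_le_of_le_one_right (by positivity) (Real.abs_cos_le_one _)).trans ?_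
      have := Real.pi_lt_four
      have h : 0 ≤ Real.pi ^ 2 * |s| := by positivity
      calc 8 * Real.pi ^ 3 * |s| = 2 * Real.pi * (4 * Real.pi ^ 2 * |s|) := by ring
        _ ≤ 2 * Real.pi * (2 * a) := by gcongr
        _ ≤ 16 * a := by nlinarith
    calc _ ≤ 16 * a * (1 + 2 * a) := by gcongr
      _ ≤ 20 * a := by nlinarith
  have t4 : |2 * distortion s x ^ 2| ≤ a := by
    rw [abs_mul, abs_pow, abs_two]
    have := pow_le_pow_left₀ (abs_nonneg _) hd 2
    nlinarith
  have t5 : |logDeriv u x * distortion s x| ≤ a := by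
    rw [abs_mul]
    have := mul_le_mul hp hd (abs_nonneg _) ha0
    nlinarith
  have t : |deriv (deriv u) x / u x - logDeriv u x ^ 2 +
      8 * Real.pi ^ 3 * s * Real.cos (2 * Real.pi * x) / couplingDeriv s x +
      2 * distortion s x ^ 2 + logDeriv u x * distortion s x| ≤ 130 * a := by
    refine (abs_add_le _ _).trans ?_
    refine (add_le_add_left (abs_add_le _ _) _).trans ?_
    refine (add_le_add_left (add_le_add_left (abs_add_le _ _) _) _).trans ?_
    have := abs_sub (deriv (deriv u) x / u x) (logDeriv u x ^ 2)
    linarith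
  rw [abs_div, div_eq_mul_inv, abs_of_pos h0]
  calc _ ≤ 130 * a * (1 + 2 * a) := by gcongr
    _ ≤ 150 * a := by nlinarith

end Rate

/-! ### Comparison of transfer operators with different frozen fields -/

/-- Preimages of a point under two nearby covering maps are close. -/
theorem abs_sub_le_of_coverLift_eq {s t x y : ℝ} (ht : 2 * Real.pi * |t| ≤ 1 / 2)
    (h : coverLift s x = coverLift t y) : |x - y| ≤ 2 * |s - t| := by
  have e : x - y = (t - s) * Real.sin (2 * Real.pi * x) +
      t * (Real.sin (2 * Real.pi * y) - Real.sin (2 * Real.pi * x)) := by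
    rw [coverLift, coverLift] at h
    linarith
  have h1 : |x - y| ≤ |s - t| + 1 / 2 * |x - y| := by
    nth_rewrite 1 [e]
    refine (abs_add_le _ _).trans (add_le_add ?_ ?_)
    · rw [abs_mul, abs_sub_comm]
      exact mul_le_of_le_one_right (abs_nonneg _) (Real.abs_sin_le_one _)
    · rw [abs_mul]
      calc _ ≤ |t| * (2 * Real.pi * |y - x|) := by
            gcongr
            exact abs_sin_two_pi_sub_le y x
        _ = 2 * Real.pi * |t| * |x - y| := by
            rw [abs_sub_comm]
            ring
        _ ≤ _ := by gcongr
  linarith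

theorem abs_branchRate_sub_le {a D s t x y : ℝ} {u v : ℝ → ℝ} (ha : a ≤ 1 / 1000000)
    (hv : IsNearlyConstant a v)
    (h : ∀ x, |logDeriv u x - logDeriv v x| ≤ D) (hs : 4 * Real.pi ^ 2 * |s| ≤ 2 * a)
    (ht : 4 * Real.pi ^ 2 * |t| ≤ 2 * a) (hst : 4 * Real.pi ^ 2 * |s - t| ≤ 142 / 100 * D)
    (hxy : coverLift s x = coverLift t y) :
    |branchRate s u x - branchRate t v y| ≤ 243 / 100 * D := by
  have ha0 := hv.nonneg
  have hD := (abs_nonneg _).trans (h 0)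
  have hpi3 := Real.pi_gt_three
  have hpi4 := Real.pi_lt_four
  have hst0 := abs_nonneg (s - t)
  have hπst : 0 ≤ Real.pi * |s - t| := by positivity
  have hst1 : 4 * Real.pi * (3 * |s - t|) ≤ 142 / 100 * D := by nlinarith
  have hst2 : 36 * |s - t| ≤ 142 / 100 * D := by nlinarith
  have hξ := abs_sub_le_of_coverLift_eq (two_pi_mul_abs_le_half ha ht) hxy
  have hπξ : 2 * Real.pi * |x - y| ≤ 1 / 2 * D := by
    have : 2 * Real.pi * |x - y| ≤ 2 * Real.pi * (2 * |s - t|) := by gcongr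
    linarith
  refine abs_rate_sub_le (q := logDeriv v x) ha (hv.abs_logDeriv_le y) (h x) ?_
    (abs_couplingDeriv_sub_one_le_of_le hs x) (abs_couplingDeriv_sub_one_le_of_le ht y) ?_ ?_ ?_
    (Real.abs_sin_le_one _) (Real.abs_sin_le_one _) ?_
  · refine (hv.abs_logDeriv_sub_le (by linarith) x y).trans ?_
    have : |x - y| ≤ 8 / 100 * D := by linarith
    calc 101 * a * |x - y| ≤ 101 * a * (8 / 100 * D) := by gcongr
      _ ≤ 10 * a * D := by
        have := mul_nonneg ha0 hD
        linarith
  · have e : couplingDeriv s x - couplingDeriv t y =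
        2 * Real.pi * (s - t) * Real.cos (2 * Real.pi * x) +
        2 * Real.pi * t * (Real.cos (2 * Real.pi * x) - Real.cos (2 * Real.pi * y)) := by
      rw [couplingDeriv, couplingDeriv]
      ring
    rw [e]
    refine (abs_add_le _ _).trans ?_
    have h1 : |2 * Real.pi * (s - t) * Real.cos (2 * Real.pi * x)| ≤ 1 / 2 * D := by
      rw [abs_mul, abs_mul, abs_of_pos Real.two_pi_pos]
      refine (mul_le_of_le_one_right (by positivity) (Real.abs_cos_le_one _)).trans ?_
      linarith
    have h2 : |2 * Real.pi * t * (Real.cos (2 * Real.pi * x) - Real.cos (2 * Real.pi * y))| ≤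
        1 / 2 * D := by
      rw [abs_mul, abs_mul, abs_of_pos Real.two_pi_pos]
      have h3 := (abs_cos_two_pi_sub_le x y).trans hπξ
      have h4 := two_pi_mul_abs_le_half ha ht
      calc _ ≤ 1 / 2 * (1 / 2 * D) := by gcongr
        _ ≤ _ := by linarith
    linarith
  · rw [abs_mul, abs_of_pos (by positivity : 0 < 4 * Real.pi ^ 2)]
    exact ht
  · rw [← mul_sub, abs_mul, abs_of_pos (by positivity : 0 < 4 * Real.pi ^ 2)]
    exact hst
  · exact ((abs_sin_two_pi_sub_le x y).trans hπξ).trans (by linarith)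

/-- Comparison of two weighted averages. -/
theorem abs_weighted_sub_le {ι : Type*} {I : Finset ι} {A B ρ σ : ι → ℝ} {ε R η κ : ℝ}
    (hI : I.Nonempty) (hA : ∀ k ∈ I, 0 < A k) (hB : ∀ k ∈ I, 0 < B k)
    (hρσ : ∀ k ∈ I, |ρ k - σ k| ≤ ε) (hσ : ∀ k ∈ I, |σ k| ≤ R)
    (hAB : ∀ k ∈ I, |A k - κ * B k| ≤ η * A k) :
    |(∑ k ∈ I, A k * ρ k) / (∑ k ∈ I, A k) - (∑ k ∈ I, B k * σ k) / (∑ k ∈ I, B k)| ≤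
      ε + 2 * R * η := by
  have hSA : 0 < ∑ k ∈ I, A k := Finset.sum_pos hA hI
  have hSB : 0 < ∑ k ∈ I, B k := Finset.sum_pos hB hI
  set m := (∑ k ∈ I, B k * σ k) / (∑ k ∈ I, B k) with hm
  have hmR : |m| ≤ R := by
    rw [hm, abs_div, abs_of_pos hSB, div_le_iff₀ hSB, Finset.mul_sum]
    refine (Finset.abs_sum_le_sum_abs _ _).trans (Finset.sum_le_sum fun k hk => ?_)
    rw [abs_mul, abs_of_pos (hB k hk), mul_comm]
    exact mul_le_mul_of_nonneg_right (hσ k hk) (hB k hk).le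
  -- Centering `σ` at its `B`-average kills any multiple of the weights `B`, so the weights need
  -- only agree up to a common factor `κ`.
  have hzero : ∑ k ∈ I, κ * B k * (σ k - m) = 0 := by
    simp only [mul_assoc, mul_sub, ← Finset.mul_sum, Finset.sum_sub_distrib]
    rw [← Finset.sum_mul, hm, mul_div_cancel₀ _ hSB.ne', sub_self]
  have e : (∑ k ∈ I, A k * ρ k) / (∑ k ∈ I, A k) - m =
      (∑ k ∈ I, (A k * (ρ k - σ k) + (A k - κ * B k) * (σ k - m))) / ∑ k ∈ I, A k := by
    have h : ∑ k ∈ I, (A k * (ρ k - σ k) + (A k - κ * B k) * (σ k - m)) =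
        ∑ k ∈ I, A k * ρ k - m * ∑ k ∈ I, A k - ∑ k ∈ I, κ * B k * (σ k - m) := by
      rw [Finset.mul_sum, ← Finset.sum_sub_distrib, ← Finset.sum_sub_distrib]
      exact Finset.sum_congr rfl fun k _ => by ring
    rw [h, hzero, sub_zero, sub_div, mul_div_cancel_right₀ _ hSA.ne']
  rw [e, abs_div, abs_of_pos hSA, div_le_iff₀ hSA, Finset.mul_sum]
  refine (Finset.abs_sum_le_sum_abs _ _).trans (Finset.sum_le_sum fun k hk => ?_)
  refine (abs_add_le _ _).trans ?_
  rw [abs_mul, abs_mul, abs_of_pos (hA k hk)]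
  have h1 : |σ k - m| ≤ 2 * R := (abs_sub _ _).trans (by linarith [hσ k hk])
  have h2 := mul_le_mul_of_nonneg_left (hρσ k hk) (hA k hk).le
  have h3 := mul_le_mul (hAB k hk) h1 (abs_nonneg _) ((abs_nonneg _).trans (hAB k hk))
  linarith

theorem abs_logDeriv_transfer_sub_le {a D s t : ℝ} {u v : ℝ → ℝ} (ha : a ≤ 1 / 1000000)
    (hDa : D ≤ 2 * a) (hu : IsNearlyConstant a u) (hv : IsNearlyConstant a v)
    (h : ∀ x, |logDeriv u x - logDeriv v x| ≤ D) (hs : 4 * Real.pi ^ 2 * |s| ≤ 2 * a)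
    (ht : 4 * Real.pi ^ 2 * |t| ≤ 2 * a) (hst : 4 * Real.pi ^ 2 * |s - t| ≤ 142 / 100 * D)
    (z : ℝ) : |logDeriv (transfer s u) z - logDeriv (transfer t v) z| ≤ 49 / 100 * D := by
  have ha0 := hv.nonneg
  have hD := (abs_nonneg _).trans (h 0)
  have hs' := two_pi_mul_abs_le_half ha hs
  have ht' := two_pi_mul_abs_le_half ha ht
  have hrate : ∀ w, |branchRate s u (coverInv s w) - branchRate t v (coverInv t w)| ≤
      243 / 100 * D := fun w => abs_branchRate_sub_le ha hv h hs ht hst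
    (by rw [coverLift_coverInv hs', coverLift_coverInv ht'])
  have hpu := branchDensity_pos hs' hu.pos
  have hpv := branchDensity_pos ht' hv.pos
  -- With this factor the weights agree at `k = 0`. The logarithm of their ratio drifts at rate
  -- `0.486 D` over a distance below 5, so by at most `2.43 D`.
  set κ := branchDensity s u z / branchDensity t v z with hκ
  have hκ0 : 0 < κ := div_pos (hpu z) (hpv z)
  have hw : ∀ k ∈ Finset.range 5, |branchDensity s u (z + k) - κ * branchDensity t v (z + k)| ≤
      5 * D * branchDensity s u (z + k) := by
    intro k hk
    have hdu : Differentiable ℝ (branchDensity s u) :=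
      (contDiff_branchDensity hs' hu.contDiff).differentiable two_ne_zero
    have hdv : Differentiable ℝ (branchDensity t v) :=
      (contDiff_branchDensity ht' hv.contDiff).differentiable two_ne_zero
    have h1 := abs_log_sub_log_sub_le hdu hdv hpu hpv (D := 243 / 500 * D) (fun x => by
      rw [logDeriv_branchDensity hs' hu.differentiable hu.pos,
        logDeriv_branchDensity ht' hv.differentiable hv.pos, ← sub_div, abs_div,
        abs_of_pos (by norm_num : (0 : ℝ) < 5), div_le_iff₀ (by norm_num)]
      linarith [hrate x]) (z + k) z
    have hk5 : (k : ℝ) ≤ 5 := by exact_mod_cast (Finset.mem_range.mp hk).le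
    have h2 : |Real.log (κ * branchDensity t v (z + k)) - Real.log (branchDensity s u (z + k))| ≤
        243 / 100 * D := by
      rw [Real.log_mul hκ0.ne' (hpv _).ne', hκ, Real.log_div (hpu _).ne' (hpv _).ne',
        abs_sub_comm]
      rw [add_sub_cancel_left, abs_of_nonneg (Nat.cast_nonneg k : (0 : ℝ) ≤ k)] at h1
      have h3 : 243 / 500 * D * k ≤ 243 / 500 * D * 5 := by gcongr
      have h4 := h1.trans h3
      convert! h4.trans (by linarith : _ ≤ 243 / 100 * D) using 2
      ring
    rw [abs_sub_comm]
    refine (abs_sub_le_two_mul_of_abs_log_le (mul_pos hκ0 (hpv _)) (hpu _) (by linarith) h2).trans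
      ?_
    exact mul_le_mul_of_nonneg_right (by linarith) (hpu (z + k)).le
  have key := abs_weighted_sub_le (I := Finset.range 5) (by simp) (fun k _ => hpu (z + k))
    (fun k _ => hpv (z + k)) (fun k _ => hrate (z + k))
    (fun k _ => hv.abs_branchRate_le ha ht (coverInv t (z + k))) hw
  rw [logDeriv_transfer hs' hu.differentiable hu.pos,
    logDeriv_transfer ht' hv.differentiable hv.pos, ← sub_div, abs_div,
    abs_of_pos (by norm_num : (0 : ℝ) < 5), div_le_iff₀ (by norm_num)]
  -- With `R = 5 a` and `η = 5 D` the total is `(2.43 + 50 a) D / 5`, below `0.49 D`.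
  have := mul_nonneg ha0 hD
  nlinarith

/-! ### The transported density -/

theorem lintegral_Ioc_natCast {F : ℝ → ℝ≥0∞} (n : ℕ) :
    ∫⁻ z in Ioc (0 : ℝ) n, F z = ∑ k ∈ Finset.range n, ∫⁻ z in Ioc (0 : ℝ) 1, F (z + k) := by
  induction n with
  | zero => simp
  | succ n ih =>
    have hn : (0 : ℝ) ≤ n := Nat.cast_nonneg n
    have hunion : Ioc (0 : ℝ) ((n + 1 : ℕ) : ℝ) = Ioc 0 (n : ℝ) ∪ Ioc (n : ℝ) (n + 1) := by
      rw [Ioc_union_Ioc_eq_Ioc hn (by linarith)]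
      push_cast
      rfl
    have hshift : ∫⁻ z in Ioc (n : ℝ) (n + 1), F z = ∫⁻ z in Ioc (0 : ℝ) 1, F (z + n) := by
      have h := (measurePreserving_add_right volume (n : ℝ)).setLIntegral_comp_preimage_emb
        (measurableEmbedding_addRight (n : ℝ)) F (Ioc (n : ℝ) (n + 1))
      rw [← h]
      simp
    rw [hunion, lintegral_union measurableSet_Ioc
      (Ioc_disjoint_Ioc_of_le le_rfl), ih, hshift, Finset.sum_range_succ]

theorem coverInv_image_Ioc {s : ℝ} (hs : 2 * Real.pi * |s| ≤ 1 / 2) :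
    coverInv s '' Ioc 0 5 = Ioc 0 1 := by
  have hmono : StrictMono (coverLift s) := strictMono_of_deriv_pos fun x => by
    rw [(hasDerivAt_coverLift s x).deriv]
    exact mul_pos (by norm_num) (couplingDeriv_pos hs x)
  have h1 : coverLift s 1 = 5 := by
    have := coverLift_add_one s 0
    rwa [zero_add, coverLift_zero, zero_add] at this
  have himage : coverInv s '' Ioc 0 5 = coverLift s ⁻¹' Ioc 0 5 :=
    congrFun (image_eq_preimage_of_inverse (coverLift_coverInv hs) (coverInv_coverLift hs)) _
  rw [himage]
  ext x
  have h2 := hmono.lt_iff_lt (a := 0) (b := x)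
  have h3 := hmono.le_iff_le (a := x) (b := 1)
  rw [coverLift_zero] at h2
  rw [h1] at h3
  simp only [mem_preimage, mem_Ioc, h2, h3]

/-- Change of variables by `coverInv s`, which carries `(0,5]` onto `(0,1]`; cutting `(0,5]` into
unit intervals and using periodicity of `g` produces the sum over branches. -/
theorem lintegral_Ioc_comp_coverLift {s : ℝ} {u : ℝ → ℝ} (hs : 2 * Real.pi * |s| ≤ 1 / 2)
    (hu : Continuous u) (hu0 : ∀ x, 0 < u x) {g : ℝ → ℝ≥0∞} (hg : Measurable g)
    (hgp : Function.Periodic g 1) :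
    ∫⁻ x in Ioc (0 : ℝ) 1, ENNReal.ofReal (u x) * g (coverLift s x) =
      ∫⁻ z in Ioc (0 : ℝ) 1, ENNReal.ofReal (transfer s u z) * g z := by
  have hinj : InjOn (coverInv s) (Ioc 0 5) :=
    (Function.LeftInverse.injective (coverLift_coverInv hs)).injOn
  have hW : Continuous (branchDensity s u) :=
    (hu.comp (continuous_coverInv hs)).div (continuous_const.mul
      (((contDiff_couplingDeriv s (n := 0)).continuous).comp (continuous_coverInv hs)))
      fun _ => (mul_pos (by norm_num) (couplingDeriv_pos hs _)).ne'
  rw [← coverInv_image_Ioc hs, lintegral_image_eq_lintegral_abs_deriv_mul measurableSet_Ioc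
    (fun z _ => (hasDerivAt_coverInv hs z).hasDerivWithinAt) hinj]
  have e1 : ∀ z, ENNReal.ofReal |(5 * couplingDeriv s (coverInv s z))⁻¹| *
      (ENNReal.ofReal (u (coverInv s z)) * g (coverLift s (coverInv s z))) =
      ENNReal.ofReal (branchDensity s u z) * g z := by
    intro z
    have hb : 0 < 5 * couplingDeriv s (coverInv s z) :=
      mul_pos (by norm_num) (couplingDeriv_pos hs _)
    rw [coverLift_coverInv hs, ← mul_assoc, ← ENNReal.ofReal_mul (abs_nonneg _),
      abs_of_pos (inv_pos.mpr hb), inv_mul_eq_div, branchDensity]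
  simp only [e1]
  have h5 := lintegral_Ioc_natCast (F := fun z => ENNReal.ofReal (branchDensity s u z) * g z) 5
  rw [Nat.cast_ofNat] at h5
  rw [h5, ← lintegral_finsetSum _ fun k _ => by
    have := hW.measurable
    fun_prop]
  -- The first rewriting also turned the right-hand domain into an image; this undoes it.
  rw [coverInv_image_Ioc hs]
  refine lintegral_congr fun z => ?_
  rw [transfer, ENNReal.ofReal_sum_of_nonneg fun k _ => (branchDensity_pos hs hu0 _).le,
    Finset.sum_mul]
  refine Finset.sum_congr rfl fun k _ => ?_
  have := hgp.nat_mul k z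
  rw [mul_one] at this
  rw [this]

theorem exSto_densityMeasure {δ : ℝ} {φ Φ : Circ → ℝ} (hφ : Continuous φ) (hΦ : Continuous Φ)
    (hφ0 : ∀ x, 0 < φ x) (hs : 2 * Real.pi * |δ * meanCos fun t => φ t| ≤ 1 / 2)
    (hT : ∀ t : ℝ, Φ t = transfer (δ * meanCos fun t => φ t) (fun t => φ t) t) :
    exSto δ (densityMeasure φ) = densityMeasure Φ := by
  have hmap : Measurable fun x => timesFive (couplingMap sinCos δ (densityMeasure φ) x) :=
    (continuous_timesFive.comp (continuous_couplingMap_sinCos δ _)).measurable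
  have hφm : Measurable fun x => ENNReal.ofReal (φ x) := hφ.measurable.ennreal_ofReal
  have hΦm : Measurable fun x => ENNReal.ofReal (Φ x) := hΦ.measurable.ennreal_ofReal
  refine Measure.ext_of_lintegral _ fun g hg => ?_
  have hL : ∀ {χ : Circ → ℝ} {G : Circ → ℝ≥0∞}, (Measurable fun x => ENNReal.ofReal (χ x)) →
      Measurable G → ∫⁻ x, G x ∂(densityMeasure χ) =
        ∫⁻ t in Ioc (0 : ℝ) 1, ENNReal.ofReal (χ t) * G t := fun {χ G} hχ hG => by
    have h := UnitAddCircle.lintegral_preimage 0 fun x : Circ => ENNReal.ofReal (χ x) * G x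
    rw [zero_add] at h
    rw [h, densityMeasure, lintegral_withDensity_eq_lintegral_mul _ hχ hG]
    rfl
  rw [exSto_eq_map, lintegral_map hg hmap, hL hφm (hg.fun_comp hmap), hL hΦm hg]
  have hmean : cosMean (densityMeasure φ) = meanCos fun t => φ t :=
    cosMean_densityMeasure hφ fun x => (hφ0 x).le
  have key := lintegral_Ioc_comp_coverLift (u := fun t : ℝ => φ t) (g := fun t : ℝ => g t) hs
    (hφ.comp (AddCircle.continuous_mk' 1)) (fun x => hφ0 x) (hg.comp AddCircle.measurable_mk')
    (fun t => by simp)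
  refine Eq.trans (lintegral_congr fun t => ?_) (key.trans (lintegral_congr fun t => ?_))
  · rw [timesFive_couplingMap_coe, hmean]
    rfl
  · rw [hT]

theorem densityMeasure_injOn {φ ψ : Circ → ℝ} (hφ : Continuous φ) (hψ : Continuous ψ)
    (hφ0 : ∀ x, 0 ≤ φ x) (hψ0 : ∀ x, 0 ≤ ψ x) (h : densityMeasure φ = densityMeasure ψ) :
    φ = ψ := by
  have h1 := (withDensity_eq_iff_of_sigmaFinite (μ := (volume : Measure Circ))
    hφ.measurable.ennreal_ofReal.aemeasurable hψ.measurable.ennreal_ofReal.aemeasurable).mp h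
  have h2 : φ =ᵐ[volume] ψ := by
    filter_upwards [h1] with x hx
    exact (ENNReal.ofReal_eq_ofReal_iff (hφ0 x) (hψ0 x)).mp hx
  exact (hφ.ae_eq_iff_eq volume hψ).mp h2

/-- `stoDensity` is defined by choice; uniqueness of continuous nonnegative densities identifies the
chosen one. -/
theorem exStoDensity_eq {δ : ℝ} {φ Φ : Circ → ℝ} (hΦ : Continuous Φ) (hΦ0 : ∀ x, 0 ≤ Φ x)
    (h : densityMeasure Φ = exSto δ (densityMeasure φ)) : exStoDensity δ φ = Φ := by
  have hex : ∃ ψ : Circ → ℝ, Continuous ψ ∧ (∀ x, 0 ≤ ψ x) ∧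
      densityMeasure ψ = sto timesFive sinCos δ (densityMeasure φ) := ⟨Φ, hΦ, hΦ0, h⟩
  rw [exStoDensity, stoDensity, dif_pos hex]
  obtain ⟨h1, h2, h3⟩ := hex.choose_spec
  exact densityMeasure_injOn h1 hΦ h2 hΦ0 (h3.trans h.symm)

/-! ### Stability of Lebesgue measure -/

theorem mem_cones_iff {a : ℝ} (ha : 0 < a) {φ : Circ → ℝ} :
    φ ∈ logLipCone a ∩ secondDerivCone (100 * a) ↔ IsNearlyConstant a fun t => φ t := by
  have hit : iteratedDeriv 2 (fun t : ℝ => φ t) = deriv (deriv fun t : ℝ => φ t) := by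
    rw [iteratedDeriv_succ, iteratedDeriv_one]
  rw [mem_inter_iff, mem_logLipCone_iff ha]
  constructor
  · rintro ⟨⟨-, h0, h1⟩, hC, -, h2⟩
    refine ⟨hC, periodic_coe_comp φ, h0, fun x => (logDeriv_abs_le_iff (h0 x)).mpr (h1 x),
      fun x => ?_⟩
    have := h2 x
    rwa [hit, abs_div, abs_of_pos (h0 x), div_le_iff₀ (h0 x)] at this
  · intro h
    refine ⟨⟨h.contDiff_one, h.pos, fun x =>
      (logDeriv_abs_le_iff (h.pos x)).mp (h.abs_logDeriv_le x)⟩, h.contDiff, fun x => ?_,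
      fun x => ?_⟩
    · induction x using QuotientAddGroup.induction_on with
      | H t => exact h.pos t
    · rw [hit, abs_div, abs_of_pos (h.pos x), div_le_iff₀ (h.pos x)]
      exact h.abs_deriv_deriv_le x

/-- The quantitative use of `|δ| < 1/π`: the left side is `2 (π|δ|) (2π|c|)`. -/
theorem mul_abs_le_of_two_pi_mul_abs_le {δ c K : ℝ} (hδ : |δ| < 1 / Real.pi)
    (hc : 2 * Real.pi * |c| ≤ 71 / 100 * K) : 4 * Real.pi ^ 2 * |δ * c| ≤ 142 / 100 * K := by
  have h1 : |δ| * Real.pi ≤ 1 := ((lt_div_iff₀ Real.pi_pos).mp hδ).le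
  have h2 : 0 ≤ 2 * Real.pi * |c| := by positivity
  rw [abs_mul]
  calc 4 * Real.pi ^ 2 * (|δ| * |c|) = 2 * ((|δ| * Real.pi) * (2 * Real.pi * |c|)) := by ring
    _ ≤ 2 * (1 * (2 * Real.pi * |c|)) := by gcongr
    _ ≤ _ := by linarith

section Stability

variable {δ a : ℝ}

theorem IsNearlyConstant.field_le {u : ℝ → ℝ} (hδ : |δ| < 1 / Real.pi) (ha : a ≤ 1 / 1000000)
    (hu : IsNearlyConstant a u) : 4 * Real.pi ^ 2 * |δ * meanCos u| ≤ 2 * a := by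
  have h := abs_meanCos_le (by linarith) hu.contDiff_one hu.pos hu.abs_logDeriv_le
  linarith [mul_abs_le_of_two_pi_mul_abs_le hδ h, hu.nonneg]

/-- The logarithmic derivatives of densities are contracted by the self-consistent operator. -/
theorem IsNearlyConstant.abs_logDeriv_transfer_sub_le {u v : ℝ → ℝ} {D : ℝ}
    (hδ : |δ| < 1 / Real.pi) (ha : a ≤ 1 / 1000000) (hDa : D ≤ 2 * a)
    (hu : IsNearlyConstant a u) (hv : IsNearlyConstant a v)
    (h : ∀ x, |logDeriv u x - logDeriv v x| ≤ D) (z : ℝ) :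
    |logDeriv (transfer (δ * meanCos u) u) z - logDeriv (transfer (δ * meanCos v) v) z| ≤
      49 / 100 * D := by
  have hc := abs_meanCos_sub_le (by linarith) hDa hu.contDiff_one hv.contDiff_one hu.pos hv.pos
    hu.abs_logDeriv_le hv.abs_logDeriv_le h
  refine MeanField.abs_logDeriv_transfer_sub_le ha hDa hu hv h (hu.field_le hδ ha)
    (hv.field_le hδ ha) ?_ z
  rw [← mul_sub]
  exact mul_abs_le_of_two_pi_mul_abs_le hδ hc

theorem transfer_zero_one : transfer 0 (fun _ => 1) = fun _ => 1 := by
  funext z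
  simp [transfer, branchDensity, couplingDeriv]

theorem IsNearlyConstant.abs_logDeriv_transfer_le {u : ℝ → ℝ} {D : ℝ}
    (hδ : |δ| < 1 / Real.pi) (ha : a ≤ 1 / 1000000) (hDa : D ≤ 2 * a)
    (hu : IsNearlyConstant a u) (h : ∀ x, |logDeriv u x| ≤ D) (z : ℝ) :
    |logDeriv (transfer (δ * meanCos u) u) z| ≤ 49 / 100 * D := by
  have := hu.abs_logDeriv_transfer_sub_le hδ ha hDa (isNearlyConstant_one hu.nonneg)
    (fun x => by simpa using h x) z
  rw [meanCos_one, mul_zero, transfer_zero_one] at this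
  simpa using this

/-- The first cone is preserved by comparison with the constant density. For the second, `R = 5 a`
and `R' = 150 a` give `a² + 12 a ≤ 100 a`. -/
theorem IsNearlyConstant.transfer {u : ℝ → ℝ} (hδ : |δ| < 1 / Real.pi) (ha : a ≤ 1 / 1000000)
    (hu : IsNearlyConstant a u) : IsNearlyConstant a (transfer (δ * meanCos u) u) := by
  have ha0 := hu.nonneg
  have hf := hu.field_le hδ ha
  have hs := two_pi_mul_abs_le_half ha hf
  refine ⟨contDiff_transfer hs hu.contDiff, transfer_periodic hs hu.periodic,
    transfer_pos hs hu.pos, fun x => ?_, fun x => ?_⟩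
  · linarith [hu.abs_logDeriv_transfer_le hδ ha (by linarith) hu.abs_logDeriv_le x]
  · refine (abs_deriv_deriv_transfer_le hs hu.contDiff hu.pos (hu.abs_branchRate_le ha hf)
      (hu.abs_deriv_branchRate_le ha hf) x).trans ?_
    refine mul_le_mul_of_nonneg_right ?_ (transfer_pos hs hu.pos x).le
    nlinarith

/-- On nearly constant densities the operator is given by `transfer`. -/
theorem exStoDensity_eq_transfer {φ : Circ → ℝ} (hδ : |δ| < 1 / Real.pi) (ha : a ≤ 1 / 1000000)
    (hφ : IsNearlyConstant a fun t => φ t) :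
    densityMeasure (exStoDensity δ φ) = exSto δ (densityMeasure φ) ∧
      (fun t : ℝ => exStoDensity δ φ t) = transfer (δ * meanCos fun t => φ t) fun t => φ t := by
  have hT := hφ.transfer hδ ha
  have hs := two_pi_mul_abs_le_half ha (hφ.field_le hδ ha)
  set Φ : Circ → ℝ := hT.periodic.lift with hΦ
  have hΦc : Continuous Φ := continuous_coinduced_dom.mpr hT.contDiff.continuous
  have hφc : Continuous φ := continuous_coinduced_dom.mpr hφ.contDiff.continuous
  have hpos : ∀ {ψ : Circ → ℝ}, (∀ t : ℝ, 0 < ψ t) → ∀ x, 0 < ψ x := fun h x => by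
    induction x using QuotientAddGroup.induction_on with
    | H t => exact h t
  have hm := exSto_densityMeasure hφc hΦc (hpos hφ.pos) hs fun t => rfl
  have e := exStoDensity_eq hΦc (fun x => (hpos (ψ := Φ) hT.pos x).le) hm.symm
  rw [e]
  exact ⟨hm.symm, rfl⟩

theorem hilbertDist_exStoDensity_le {φ ψ : Circ → ℝ} (hδ : |δ| < 1 / Real.pi) (ha0 : 0 < a)
    (ha : a ≤ 1 / 1000000) (hφ : φ ∈ logLipCone a ∩ secondDerivCone (100 * a))
    (hψ : ψ ∈ logLipCone a ∩ secondDerivCone (100 * a)) :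
    hilbertDist (logLipCone a) (exStoDensity δ φ) (exStoDensity δ ψ) ≤
      ((97 / 100 : ℝ) : EReal) * hilbertDist (logLipCone a) φ ψ := by
  have hlow := abs_logDeriv_sub_le_hilbertDist ha0 hφ.1 hψ.1
  have hu := (mem_cones_iff ha0).mp hφ
  have hv := (mem_cones_iff ha0).mp hψ
  have eu := (exStoDensity_eq_transfer hδ ha hu).2
  have ev := (exStoDensity_eq_transfer hδ ha hv).2
  have hΦ : exStoDensity δ φ ∈ logLipCone a ∩ secondDerivCone (100 * a) := by
    rw [mem_cones_iff ha0, eu]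
    exact hu.transfer hδ ha
  have hΨ : exStoDensity δ ψ ∈ logLipCone a ∩ secondDerivCone (100 * a) := by
    rw [mem_cones_iff ha0, ev]
    exact hv.transfer hδ ha
  induction hd : hilbertDist (logLipCone a) φ ψ with
  | bot =>
    have := hlow 0
    rw [hd] at this
    exact absurd (le_bot_iff.mp this) (EReal.coe_ne_bot _)
  | top =>
    rw [EReal.coe_mul_top_of_pos (by norm_num)]
    exact le_top
  | coe d =>
    rw [← EReal.coe_mul]
    have hdist : ∀ t : ℝ, |logDeriv (fun t : ℝ => φ t) t - logDeriv (fun t : ℝ => ψ t) t| ≤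
        a / 2 * d := fun t => by
      have := hlow t
      rw [hd, EReal.coe_le_coe_iff, div_mul_eq_mul_div, div_le_iff₀ ha0] at this
      linarith
    have hd0 : 0 ≤ d := by
      have := (abs_nonneg _).trans (hdist 0)
      exact nonneg_of_mul_nonneg_right this (by positivity)
    -- The slack `τ` is needed because `hilbertDist_le` asks for `D > 0`, while `d` may be 0.
    refine EReal.le_of_forall_lt_iff_le.mp fun c hc => ?_
    rw [EReal.coe_lt_coe_iff] at hc
    set τ := c - 97 / 100 * d with hτ
    have hτ0 : 0 < τ := sub_pos.mpr hc
    -- The cap `2 a` costs nothing, as both logarithmic derivatives are at most `a`, and it keeps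
    -- `D` small when `d` is large.
    set D := min (a / 2 * (d + τ)) (2 * a) with hD
    have hD0 : 0 < D := by positivity
    have hDa : D ≤ 2 * a := min_le_right _ _
    have hDd : D ≤ a / 2 * (d + τ) := min_le_left _ _
    have hDle : ∀ t : ℝ, |logDeriv (fun t : ℝ => φ t) t - logDeriv (fun t : ℝ => ψ t) t| ≤ D :=
      fun t => le_min ((hdist t).trans (by nlinarith)) ((abs_sub _ _).trans
        (by linarith [hu.abs_logDeriv_le t, hv.abs_logDeriv_le t]))
    have h := hilbertDist_le (l := 49 / 100) (D := 49 / 100 * D) ha0 (by norm_num)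
      (by positivity) hΦ.1 hΨ.1
      (by rw [eu]; exact hu.abs_logDeriv_transfer_le hδ ha (by linarith) hu.abs_logDeriv_le)
      (by rw [ev]; exact hv.abs_logDeriv_transfer_le hδ ha (by linarith) hv.abs_logDeriv_le)
      (by rw [eu, ev]; exact hu.abs_logDeriv_transfer_sub_le hδ ha hDa hv hDle)
    refine h.trans (EReal.coe_le_coe_iff.mpr ?_)
    calc 2 * (49 / 100 * D + 49 / 100 * D / ((1 - 49 / 100) * a))
        = 98 / 100 * (1 + 1 / (51 / 100 * a)) * D := by
          field_simp
          ring
      _ ≤ 98 / 100 * (1 + 1 / (51 / 100 * a)) * (a / 2 * (d + τ)) := by gcongr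
      _ = (49 / 100 * a + 49 / 51) * (d + τ) := by
          field_simp
          ring
      -- `49/51 = λ / (1 - λ)` with `λ = 0.49` is below `0.961`, and `a` is tiny.
      _ ≤ 97 / 100 * (d + τ) := by
          gcongr
          linarith
      _ ≤ c := by linarith

theorem tendsto_hilbertDist_iterate {φ : Circ → ℝ} (hδ : |δ| < 1 / Real.pi) (ha0 : 0 < a)
    (ha : a ≤ 1 / 1000000) (hφ : φ ∈ logLipCone a ∩ secondDerivCone (100 * a)) :
    Tendsto (fun n : ℕ => hilbertDist (logLipCone a) ((exStoDensity δ)^[n] φ) fun _ => 1)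
      atTop (𝓝 0) := by
  have hone : (fun _ => 1 : Circ → ℝ) ∈ logLipCone a ∩ secondDerivCone (100 * a) :=
    (mem_cones_iff ha0).mpr (isNearlyConstant_one ha0.le)
  have hiter : ∀ n : ℕ, IsNearlyConstant a (fun t : ℝ => (exStoDensity δ)^[n] φ t) ∧
      ∀ t : ℝ, |logDeriv (fun t : ℝ => (exStoDensity δ)^[n] φ t) t| ≤ (49 / 100) ^ n * a := by
    intro n
    induction n with
    | zero =>
      have h := (mem_cones_iff ha0).mp hφ
      exact ⟨h, fun t => by simpa using h.abs_logDeriv_le t⟩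
    | succ n ih =>
      obtain ⟨h1, h2⟩ := ih
      have hle : (49 / 100 : ℝ) ^ n ≤ 1 := pow_le_one₀ (by norm_num) (by norm_num)
      simp only [Function.iterate_succ_apply']
      rw [(exStoDensity_eq_transfer hδ ha h1).2]
      refine ⟨h1.transfer hδ ha, fun t => ?_⟩
      rw [pow_succ', mul_assoc]
      exact h1.abs_logDeriv_transfer_le hδ ha (by nlinarith) h2 t
  -- The zeroth term is dropped: only from the first image on are logarithmic derivatives at most
  -- `0.49 a`, as `hilbertDist_le` requires here.
  rw [← tendsto_add_atTop_iff_nat 1]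
  have hlim : Tendsto (fun n : ℕ => ((2 * ((49 / 100) ^ (n + 1) * a +
      (49 / 100) ^ (n + 1) * a / ((1 - 49 / 100) * a)) : ℝ) : EReal)) atTop (𝓝 0) := by
    rw [← EReal.coe_zero, EReal.tendsto_coe]
    have h := ((tendsto_pow_atTop_nhds_zero_of_lt_one (r := (49 / 100 : ℝ)) (by norm_num)
      (by norm_num)).comp (tendsto_add_atTop_nat 1)).mul_const a
    rw [zero_mul] at h
    simpa using (h.add (h.div_const ((1 - 49 / 100) * a))).const_mul 2
  refine tendsto_of_tendsto_of_tendsto_of_le_of_le tendsto_const_nhds hlim (fun n => ?_)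
    fun n => ?_
  · have h := abs_logDeriv_sub_le_hilbertDist ha0
      ((mem_cones_iff ha0).mpr (hiter (n + 1)).1).1 hone.1 0
    refine le_trans ?_ h
    rw [← EReal.coe_zero, EReal.coe_le_coe_iff]
    positivity
  · refine hilbertDist_le ha0 (by norm_num) (by positivity)
      ((mem_cones_iff ha0).mpr (hiter (n + 1)).1).1 hone.1 (fun t => ?_) (fun t => ?_) fun t => ?_
    · refine ((hiter (n + 1)).2 t).trans ?_
      have hle : (49 / 100 : ℝ) ^ n ≤ 1 := pow_le_one₀ (by norm_num) (by norm_num)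
      rw [pow_succ']
      gcongr
      linarith
    · simpa using ha0.le
    · simpa using (hiter (n + 1)).2 t

theorem lebesgueHilbertStable (hδ : |δ| < 1 / Real.pi) : LebesgueHilbertStable δ := by
  refine ⟨exSto_volume δ, fun ε hε => ?_⟩
  have ha0 : 0 < min (ε / 200) (1 / 1000000) := by positivity
  have ha1 : min (ε / 200) (1 / 1000000) ≤ ε / 200 := min_le_left _ _
  have ha : min (ε / 200) (1 / 1000000 : ℝ) ≤ 1 / 1000000 := min_le_right _ _
  generalize min (ε / 200) (1 / 1000000 : ℝ) = a at ha0 ha1 ha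
  refine ⟨a, ⟨ha0, by linarith⟩, 100 * a, ⟨by positivity, by linarith⟩, fun φ hφ => ?_,
    ⟨97 / 100, by norm_num, fun φ hφ ψ hψ => hilbertDist_exStoDensity_le hδ ha0 ha hφ hψ⟩,
    fun φ hφ => tendsto_hilbertDist_iterate hδ ha0 ha hφ⟩
  have h := (mem_cones_iff ha0).mp hφ
  obtain ⟨h1, h2⟩ := exStoDensity_eq_transfer hδ ha h
  refine ⟨h1, ?_⟩
  rw [mem_cones_iff ha0, h2]
  exact h.transfer hδ ha

end Stability

end MeanField

/-! ### Assembly of the theorem -/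

theorem mainTheorem3 :
    (∀ δ : ℝ, MeanField.exSto δ volume = volume ∧
      MeanField.exSto δ (Measure.dirac 0) = Measure.dirac 0) ∧
    (∀ δ : ℝ, |δ| < 1 / Real.pi → MeanField.LebesgueHilbertStable δ) ∧
    (∀ δ : ℝ, |5 * (1 + 2 * Real.pi * δ)| < 1 →
      |δ| < 1 / Real.pi ∧ MeanField.DiracWassersteinStable δ) ∧
    (∀ᶠ δ : ℝ in 𝓝 (-(1 / (2 * Real.pi))),
      |δ| < 1 / Real.pi ∧ MeanField.LebesgueHilbertStable δ ∧
        MeanField.DiracWassersteinStable δ) ∧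
    (volume : Measure MeanField.Circ) ≠ Measure.dirac 0 := by
  refine ⟨fun δ => ⟨MeanField.exSto_volume δ, MeanField.exSto_dirac δ⟩,
    fun δ hδ => MeanField.lebesgueHilbertStable hδ,
    fun δ hδ => ⟨MeanField.abs_lt_one_div_pi_of_abs_lt_one hδ,
      MeanField.diracWassersteinStable hδ⟩, ?_, MeanField.volume_ne_dirac⟩
  have hc : Continuous fun δ : ℝ => |5 * (1 + 2 * Real.pi * δ)| := by fun_prop
  -- At `δ = -1/(2π)` the multiplier at 0 vanishes, so the open condition of the third claim holds
  -- nearby.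
  have h0 : |5 * (1 + 2 * Real.pi * -(1 / (2 * Real.pi)))| < 1 := by
    have := Real.pi_pos.ne'
    have e : 5 * (1 + 2 * Real.pi * -(1 / (2 * Real.pi))) = 0 := by
      field_simp
      ring
    rw [e, abs_zero]
    exact one_pos
  filter_upwards [hc.continuousAt.eventually_lt continuousAt_const h0] with δ hδ
  have hπ := MeanField.abs_lt_one_div_pi_of_abs_lt_one hδ
  exact ⟨hπ, MeanField.lebesgueHilbertStable hπ, MeanField.diracWassersteinStable hδ⟩
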